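/- Let $N$ be a finite ground set with $d=|N|$. Let $\gamma\sim P$ be a random variable and let $f_\gamma:2^N\to\mathbb R$ be random set functions such that $f(S)=\mathbb E_\gamma[f_\gamma(S)]$ is finite, nonnegative and submodular (not necessarily monotone). Let $D_\gamma=\max_{S\subseteq N,\,i\in N}|f_\gamma(S\cup\{i\})-f_\gamma(S)|$ and assume that $D_f=\sqrt{\mathbb E_\gamma[D_\gamma^2]}$ is finite. Let $\mathcal I\ni\emptyset$ be a family of subsets of $N$ closed under taking subsets (for instance the independent sets of a matroid), let $r=\max_{I\in\mathcal I}|I|$ be its rank, and let $\mathcal C=\mathrm{conv}\{\mathbf 1_I: I\in\mathcal I\}$. Let $F(\mathbf x)=\sum_{S\subseteq N}f(S)\prod_{i\in S}x_i\prod_{i\notin S}(1-x_i)$ be the multilinear extension of $f$. Fix $T\ge 1$ and mini-batch sizes $|\mathcal M|\ge 2T$ and $|\mathcal M_0|\ge T^2/(2r^2)$ (the latter condition is void if $r=0$). For $\mathbf x\in[0,1]^N$, a random set drawn at $\mathbf x$ means one that contains each $i$ independently with probability $x_i$. Consider the following measured stochastic continuous greedy method. Put $\mathbf x^0=0$ and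 $$[\mathbf g^0]_i=\frac1{|\mathcal M_0|}\sum_{k=1}^{|\mathcal M_0|}\bigl(f_{\gamma_k}(S_k\cup\{i\})-f_{\gamma_k}(S_k\setminus\{i\})\bigr),$$ where $\gamma_k\sim P$ and $S_k$ is drawn at $\mathbf x^0$, all independent. For $1\le t\le T-1$ put $$\mathbf g^t=\mathbf g^{t-1}+\frac1{|\mathcal M|}\sum_{k=1}^{|\mathcal M|}\tilde\nabla_k^2(\mathbf x^t-\mathbf x^{t-1}),$$ where, for fresh samples that are independent of each other and of the past, $a_k$ is uniform on $[0,1]$, $\gamma_k\sim P$, $S_k$ is drawn at $a_k\mathbf x^t+(1-a_k)\mathbf x^{t-1}$ (with $\gamma_k$ independent of $(a_k,S_k)$), $[\tilde\nabla_k^2]_{ii}=0$, and for $i\ne j$ $$[\tilde\nabla_k^2]_{ij}=f_{\gamma_k}(S_k\cup\{i,j\})-f_{\gamma_k}((S_k\cup\{i\})\setminus\{j\})-f_{\gamma_k}((S_k\cup\{j\})\setminus\{i\})+f_{\gamma_k}(S_k\setminus\{i,j\}).$$ For $0\le t\le T-1$ let $\mathbf v^t$ be a maximizer (measurably chosen,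 without using future samples) of $\langle\mathbf v,\mathbf g^t\rangle$ over $\{\mathbf v\in\mathcal C:\mathbf v\le \mathbf 1-\mathbf x^t\}$, and put $\mathbf x^{t+1}=\mathbf x^t+\frac1T\mathbf v^t$. Then $F(\mathbf x^T)$ is integrable and, for a maximizer $\mathbf x^*$ of $F$ over $\mathcal C$ (equivalently, for every $\mathbf x^*\in\mathcal C$), $$\mathbb E[F(\mathbf x^T)]\ \ge\ e^{-1}F(\mathbf x^*)-\frac{2.5\sqrt{r^3d}\,D_f}{T}.$$ -/

import Mathlib

open MeasureTheory ProbabilityTheory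

namespace StochSubmod

/-- Submodularity of a set function on the subsets of a finite ground set. -/
def IsSubmodular {N : Type*} [DecidableEq N] (f : Finset N → ℝ) : Prop :=
  ∀ A B : Finset N, f (A ∪ B) + f (A ∩ B) ≤ f A + f B

/-- The multilinear extension `F(x) = ∑_S f(S) ∏_{i ∈ S} x_i ∏_{i ∉ S} (1 - x_i)`. -/
noncomputable def multilinearExt {N : Type*} [Fintype N] [DecidableEq N]
    (f : Finset N → ℝ) (x : N → ℝ) : ℝ :=
  ∑ S : Finset N, f S * ((∏ i ∈ S, x i) * ∏ i ∈ Sᶜ, (1 - x i))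

/-- The set function `f(S) = E_γ[f_γ(S)]`. -/
noncomputable def meanFun {N Γ : Type*} [MeasurableSpace Γ] (P : Measure Γ)
    (fγ : Γ → Finset N → ℝ) (S : Finset N) : ℝ :=
  ∫ γ, fγ γ S ∂P

/-- The 0/1 indicator vector of a set. -/
def indicatorVec {N : Type*} [DecidableEq N] (S : Finset N) : N → ℝ :=
  fun i => if i ∈ S then 1 else 0

/-- The convex hull of the indicator vectors of the feasible sets (the matroid polytope when `ℐ` is
the family of independent sets of a matroid). -/
def feasiblePolytope {N : Type*} [DecidableEq N] (ℐ : Finset (Finset N)) : Set (N → ℝ) :=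
  convexHull ℝ (indicatorVec '' (ℐ : Set (Finset N)))

/-- The rank: the largest cardinality of a feasible set. -/
def rank {N : Type*} (ℐ : Finset (Finset N)) : ℕ :=
  ℐ.sup Finset.card

/-- The maximal marginal return of a set function, `max_{S, i} |f(S ∪ {i}) - f(S)|`
(a maximum over a finite index set; it is `0` for the empty ground set). -/
noncomputable def maxMarginal {N : Type*} [DecidableEq N] (f : Finset N → ℝ) : ℝ :=
  ⨆ p : Finset N × N, |f (insert p.2 p.1) - f p.1|

/-- `D_f = √(E_γ[D_γ²])`, where `D_γ` is the maximal marginal return of `f_γ`. -/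
noncomputable def marginalBound {N Γ : Type*} [DecidableEq N] [MeasurableSpace Γ] (P : Measure Γ)
    (fγ : Γ → Finset N → ℝ) : ℝ :=
  √(∫ γ, maxMarginal (fγ γ) ^ 2 ∂P)

/-- The set `N(z)` of a Bernoulli vector `z` with independent coordinates of means `x i ∈ [0, 1]`,
drawn by means of uniform variables `u i`: `z i = 1` iff `u i < x i`. -/
noncomputable def bernoulliSet {N : Type*} [Fintype N] (x : N → ℝ) (u : N → unitInterval) :
    Finset N :=
  {i | (u i : ℝ) < x i}

/-- The estimator of the gradient of the multilinear extension from the sampled set `S`. -/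
def gradSample {N : Type*} [DecidableEq N] (f : Finset N → ℝ) (S : Finset N) (i : N) : ℝ :=
  f (insert i S) - f (S.erase i)

/-- The estimator of the Hessian of the multilinear extension from the sampled set `S`: the second
difference of `f` in the coordinates `i ≠ j`; the diagonal vanishes. -/
def hessSample {N : Type*} [DecidableEq N] (f : Finset N → ℝ) (S : Finset N) (i j : N) : ℝ :=
  if i = j then 0
  else f (insert i (insert j S)) - f ((insert i S).erase j) - f ((insert j S).erase i)
    + f ((S.erase i).erase j)

/-- The mini-batch gradient estimator at `x`; a seed is a pair `(γ, u)`. -/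
noncomputable def batchGrad {N Γ : Type*} [Fintype N] [DecidableEq N]
    (fγ : Γ → Finset N → ℝ) {M₀ : ℕ} (ξ : Fin M₀ → Γ × (N → unitInterval)) (x : N → ℝ) (i : N) : ℝ :=
  (1 / (M₀ : ℝ)) * ∑ k, gradSample (fγ (ξ k).1) (bernoulliSet x (ξ k).2) i

/-- The mini-batch Hessian estimator on the segment from `x'` to `x`; a seed is a triple
`(γ, a, u)` and its Bernoulli vector is drawn at the point `a x + (1 - a) x'`. -/
noncomputable def batchHess {N Γ : Type*} [Fintype N] [DecidableEq N]
    (fγ : Γ → Finset N → ℝ) {M : ℕ} (ξ : Fin M → Γ × unitInterval × (N → unitInterval))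
    (x x' : N → ℝ) : Matrix N N ℝ :=
  fun i j => (1 / (M : ℝ)) * ∑ k, hessSample (fγ (ξ k).1)
    (bernoulliSet (((ξ k).2.1 : ℝ) • x + (1 - ((ξ k).2.1 : ℝ)) • x') (ξ k).2.2) i j

/-- A `T`-round run of the measured variant of the variance-reduced stochastic continuous greedy
algorithm on the multilinear extension, with initial batch size `M₀` and batch size `M`.

The seeds `ξ₀ k` and `ξ t k` (`1 ≤ t < T`) are the samples: within a batch they are i.i.d. with
`γ ∼ P` and with independent uniform variables on `[0, 1]`, and each batch is independent of the
past `ℱ`. The direction `v t` is any maximizer of the linear subproblem, chosen measurably from what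
is known at time `t`. -/
structure IsMeasuredRun {N Γ Ω : Type*} [Fintype N] [DecidableEq N] [MeasurableSpace Γ]
    [mΩ : MeasurableSpace Ω] (P : Measure Γ) (fγ : Γ → Finset N → ℝ) (ℐ : Finset (Finset N))
    (T M₀ M : ℕ) (μ : Measure Ω) (ℱ : Filtration ℕ mΩ)
    (ξ₀ : Fin M₀ → Ω → Γ × (N → unitInterval))
    (ξ : ℕ → Fin M → Ω → Γ × unitInterval × (N → unitInterval))
    (x g v : ℕ → Ω → N → ℝ) : Prop where
  seed_zero_meas : ∀ k, Measurable[ℱ 0] (ξ₀ k)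
  seed_zero_law : ∀ k, μ.map (ξ₀ k) = P.prod (Measure.pi fun _ => volume)
  seed_zero_indep : iIndepFun ξ₀ μ
  seed_meas : ∀ t, t + 1 < T → ∀ k, Measurable[ℱ (t + 1)] (ξ (t + 1) k)
  seed_law : ∀ t, t + 1 < T → ∀ k,
    μ.map (ξ (t + 1) k) = P.prod (volume.prod (Measure.pi fun _ => volume))
  seed_indep : ∀ t, t + 1 < T → iIndepFun (ξ (t + 1)) μ
  seed_fresh : ∀ t, t + 1 < T →
    Indep (⨆ k, MeasurableSpace.comap (ξ (t + 1) k) inferInstance) (ℱ t) μ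
  x_zero : ∀ ω, x 0 ω = 0
  g_zero : ∀ ω, g 0 ω = batchGrad fγ (fun k => ξ₀ k ω) (x 0 ω)
  g_succ : ∀ t, t + 1 < T → ∀ ω, g (t + 1) ω = g t ω +
    (batchHess fγ (fun k => ξ (t + 1) k ω) (x (t + 1) ω) (x t ω)).mulVec (x (t + 1) ω - x t ω)
  v_meas : ∀ t, t < T → Measurable[ℱ t] (v t)
  v_mem : ∀ t, t < T → ∀ ω, v t ω ∈ feasiblePolytope ℐ ∧ v t ω ≤ 1 - x t ω
  v_max : ∀ t, t < T → ∀ ω, ∀ w ∈ feasiblePolytope ℐ, w ≤ 1 - x t ω →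
    w ⬝ᵥ g t ω ≤ v t ω ⬝ᵥ g t ω
  x_succ : ∀ t, t < T → ∀ ω, x (t + 1) ω = x t ω + (1 / (T : ℝ)) • v t ω

end StochSubmod

/-! Write `F` for the multilinear extension of the mean function, `q = 1 - 1/T`, `r` for the rank,
`d = |N|`, `D` for `marginalBound`. The proof combines a measured continuous greedy analysis with a
variance bound for the recursive gradient estimator.

Greedy side. The constraint `v ≤ 1 - x` keeps every coordinate of `x^t` below `1 - q^t`
(`IsMeasuredRun.x_le`). For feasible `y` the direction `w = y(1 - x)` is feasible and respects the
same constraint. Since `F` is concave along nonnegative directions and nonnegative on the cube, `F(x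
+ w) ≥ q^t F(y)` (`IsSubmodular.le_multilinearExt_probSum`), whence `⟨w, ∇F(x)⟩ ≥ q^t F(y) - F(x)`.
As `v` beats `w` against `g`, it nearly does so against `∇F`. Young's inequality with parameter `α`
charges the difference `αr + ‖g - ∇F‖²/(2α)`, and the second-order loss of a step is at most
`D(r/T)²` (`IsSubmodular.greedy_step_le`).

Stochastic side. The Hessian correction is unbiased for `∇F(x^t) - ∇F(x^{t-1})`, and its samples are
independent of the past, so in mean square the errors add without cross terms. Each correction
contributes at most `(2r/T)² D²/M` per coordinate (`IsMeasuredRun.lintegral_gradErr_succ_le`). With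
the given batch sizes `E‖g - ∇F‖²` has order `d r² D²/T²`, and `α` of order `√(rd) D/T` makes the
total error of order `√(r³d) D/T`.

Taking expectations gives a linear recursion, solved in closed form by `le_of_greedy_recursion`; the
bound `q^(T-1) ≥ 1/e` supplies the approximation factor. -/

namespace StochSubmod

/-! ### The multilinear extension -/

section Multilinear

set_option linter.unusedSectionVars false

variable {N : Type*} [Fintype N] [DecidableEq N]

/-- The probability that the random set drawn at `x` is `S`. -/
noncomputable def bernoulliWeight (x : N → ℝ) (S : Finset N) : ℝ :=
  (∏ i ∈ S, x i) * ∏ i ∈ Sᶜ, (1 - x i)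

theorem multilinearExt_eq_sum_weight (f : Finset N → ℝ) (x : N → ℝ) :
    multilinearExt f x = ∑ S, f S * bernoulliWeight x S := rfl

theorem bernoulliWeight_eq_prod (x : N → ℝ) (S : Finset N) :
    bernoulliWeight x S = ∏ i, if i ∈ S then x i else 1 - x i := by
  rw [bernoulliWeight, Finset.prod_ite]
  congr 2 <;> ext i <;> simp

theorem sum_bernoulliWeight (x : N → ℝ) : ∑ S, bernoulliWeight x S = 1 := by
  have h := Finset.prod_add x (fun i => 1 - x i) Finset.univ
  simp only [add_sub_cancel, Finset.prod_const_one, Finset.powerset_univ] at h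
  rw [h]
  simp [bernoulliWeight, Finset.compl_eq_univ_sdiff]

theorem bernoulliWeight_nonneg {x : N → ℝ} (h0 : 0 ≤ x) (h1 : x ≤ 1) (S : Finset N) :
    0 ≤ bernoulliWeight x S :=
  mul_nonneg (Finset.prod_nonneg fun i _ => h0 i)
    (Finset.prod_nonneg fun i _ => sub_nonneg.2 (h1 i))

theorem multilinearExt_mono {f g : Finset N → ℝ} (h : ∀ S, f S ≤ g S) {x : N → ℝ}
    (h0 : 0 ≤ x) (h1 : x ≤ 1) : multilinearExt f x ≤ multilinearExt g x :=
  Finset.sum_le_sum fun S _ => mul_le_mul_of_nonneg_right (h S) (bernoulliWeight_nonneg h0 h1 S)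

theorem multilinearExt_const (c : ℝ) (x : N → ℝ) : multilinearExt (fun _ => c) x = c := by
  rw [multilinearExt_eq_sum_weight, ← Finset.mul_sum, sum_bernoulliWeight, mul_one]

theorem multilinearExt_nonneg {f : Finset N → ℝ} (h : ∀ S, 0 ≤ f S) {x : N → ℝ}
    (h0 : 0 ≤ x) (h1 : x ≤ 1) : 0 ≤ multilinearExt f x :=
  Finset.sum_nonneg fun S _ => mul_nonneg (h S) (bernoulliWeight_nonneg h0 h1 S)

theorem continuous_multilinearExt (f : Finset N → ℝ) : Continuous (multilinearExt f) := by
  unfold multilinearExt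
  fun_prop

theorem sum_eq_sum_insert (φ : Finset N → ℝ) (j : N) :
    ∑ S, φ S = ∑ S with j ∉ S, (φ S + φ (insert j S)) := by
  rw [Finset.sum_add_distrib, ← Finset.sum_filter_not_add_sum_filter Finset.univ (fun S => j ∈ S)]
  congr 1
  refine Finset.sum_nbij' (fun S => S.erase j) (fun S => insert j S) ?_ ?_ ?_ ?_ ?_
  · simp
  · simp
  · intro S hS
    exact Finset.insert_erase (by simpa using hS)
  · intro S hS
    exact Finset.erase_insert (by simpa using hS)
  · intro S hS
    rw [Finset.insert_erase (by simpa using hS)]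

/-- Pairing `S` with `insert j S`: the two weights share all factors except that of `j`, and those
two factors sum to `1`. The left side is what the product rule yields for `∂F/∂x_j`. -/
theorem multilinearExt_gradSample (f : Finset N → ℝ) (x : N → ℝ) (j : N) :
    ∑ S : Finset N, f S * ((∏ i ∈ Finset.univ.erase j, if i ∈ S then x i else 1 - x i) *
      if j ∈ S then 1 else -1) = multilinearExt (fun S => gradSample f S j) x := by
  rw [multilinearExt_eq_sum_weight, sum_eq_sum_insert _ j, sum_eq_sum_insert _ j]
  refine Finset.sum_congr rfl fun S hS => ?_
  have hj : j ∉ S := by simpa using hS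
  have hp : ∏ i ∈ Finset.univ.erase j, (if i ∈ insert j S then x i else 1 - x i) =
      ∏ i ∈ Finset.univ.erase j, (if i ∈ S then x i else 1 - x i) := by
    refine Finset.prod_congr rfl fun i hi => ?_
    simp [Finset.ne_of_mem_erase hi]
  rw [bernoulliWeight_eq_prod, bernoulliWeight_eq_prod,
    ← Finset.mul_prod_erase _ _ (Finset.mem_univ j),
    ← Finset.mul_prod_erase _ (fun i => if i ∈ insert j S then x i else 1 - x i)
      (Finset.mem_univ j), hp]
  simp only [gradSample, hj, if_false, Finset.mem_insert_self, if_true, Finset.insert_idem,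
    Finset.erase_insert hj, Finset.erase_eq_of_notMem hj]
  ring

theorem hasDerivAt_multilinearExt (f : Finset N → ℝ) (x w : N → ℝ) (s : ℝ) :
    HasDerivAt (fun s : ℝ => multilinearExt f (x + s • w))
      (∑ j, w j * multilinearExt (fun S => gradSample f S j) (x + s • w)) s := by
  have key : ∀ S : Finset N, HasDerivAt (fun s : ℝ => f S * bernoulliWeight (x + s • w) S)
      (f S * ∑ j, (∏ i ∈ Finset.univ.erase j, if i ∈ S then (x + s • w) i else 1 - (x + s • w) i) *
        (if j ∈ S then w j else - w j)) s := by
    intro S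
    simp only [bernoulliWeight_eq_prod]
    refine HasDerivAt.const_mul _ ?_
    have h : ∀ i ∈ (Finset.univ : Finset N), HasDerivAt
        (fun s : ℝ => if i ∈ S then (x + s • w) i else 1 - (x + s • w) i)
        (if i ∈ S then w i else - w i) s := by
      intro i _
      have h1 : HasDerivAt (fun s : ℝ => (x + s • w) i) (w i) s := by
        simpa using ((hasDerivAt_id s).mul_const (w i)).const_add (x i)
      split_ifs
      · exact h1
      · simpa using h1.const_sub 1
    simpa using HasDerivAt.fun_finsetProd h
  have h := HasDerivAt.fun_sum fun S (_ : S ∈ (Finset.univ : Finset (Finset N))) => key S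
  refine h.congr_deriv ?_
  simp only [← multilinearExt_gradSample, Finset.mul_sum]
  rw [Finset.sum_comm]
  refine Finset.sum_congr rfl fun j _ => Finset.sum_congr rfl fun S _ => ?_
  split_ifs <;> ring

theorem insert_erase_self (S : Finset N) (i : N) : insert i (S.erase i) = insert i S := by
  ext k
  by_cases h : k = i <;> simp [h]

/-- Lets every fact about second differences follow from first differences applied twice. The
diagonal vanishes because `gradSample f S i` does not depend on whether `i ∈ S`. -/
theorem gradSample_gradSample (f : Finset N → ℝ) (S : Finset N) (i j : N) :
    gradSample (fun S => gradSample f S i) S j = hessSample f S i j := by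
  unfold gradSample hessSample
  split_ifs with h
  · subst h
    simp [insert_erase_self]
  · rw [Finset.erase_insert_of_ne h, Finset.erase_right_comm]
    ring

theorem hasDerivAt_multilinearExt_gradSample (f : Finset N → ℝ) (x w : N → ℝ) (i : N) (s : ℝ) :
    HasDerivAt (fun s : ℝ => multilinearExt (fun S => gradSample f S i) (x + s • w))
      (∑ j, w j * multilinearExt (fun S => hessSample f S i j) (x + s • w)) s := by
  simpa only [gradSample_gradSample] using
    hasDerivAt_multilinearExt (fun S => gradSample f S i) x w s

theorem le_taylor_of_deriv2_le {φ φ' φ'' : ℝ → ℝ} {C : ℝ} (h1 : ∀ s, HasDerivAt φ (φ' s) s)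
    (h2 : ∀ s, HasDerivAt φ' (φ'' s) s) (hC : ∀ s ∈ Set.Icc (0 : ℝ) 1, φ'' s ≤ C) :
    φ 1 ≤ φ 0 + φ' 0 + C / 2 := by
  have m1 : AntitoneOn (fun s => φ' s - C * s) (Set.Icc (0 : ℝ) 1) := by
    have hd : ∀ s, HasDerivAt (fun s => φ' s - C * s) (φ'' s - C) s := fun s => by
      simpa using (h2 s).fun_sub ((hasDerivAt_id' s).const_mul C)
    refine antitoneOn_of_deriv_nonpos (convex_Icc 0 1)
      (fun s _ => (hd s).continuousAt.continuousWithinAt)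
      (fun s _ => (hd s).differentiableAt.differentiableWithinAt) fun s hs => ?_
    rw [(hd s).deriv]
    linarith [hC s (interior_subset hs)]
  have m2 : AntitoneOn (fun s => φ s - φ' 0 * s - C / 2 * s ^ 2) (Set.Icc (0 : ℝ) 1) := by
    have hd : ∀ s, HasDerivAt (fun s => φ s - φ' 0 * s - C / 2 * s ^ 2)
        (φ' s - φ' 0 - C * s) s := fun s => by
      refine (((h1 s).sub ((hasDerivAt_id s).const_mul (φ' 0))).sub
        ((hasDerivAt_pow 2 s).const_mul (C / 2))).congr_deriv ?_
      simp
      ring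
    refine antitoneOn_of_deriv_nonpos (convex_Icc 0 1)
      (fun s _ => (hd s).continuousAt.continuousWithinAt)
      (fun s _ => (hd s).differentiableAt.differentiableWithinAt) fun s hs => ?_
    rw [(hd s).deriv]
    have hs' := interior_subset hs
    have := m1 (Set.left_mem_Icc.2 zero_le_one) hs' hs'.1
    simp only [mul_zero, sub_zero] at this
    linarith
  have := m2 (Set.left_mem_Icc.2 zero_le_one) (Set.right_mem_Icc.2 zero_le_one) zero_le_one
  norm_num at this
  linarith

/-- The gradient of the multilinear extension. -/
noncomputable def multilinearGrad (f : Finset N → ℝ) (x : N → ℝ) (i : N) : ℝ :=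
  multilinearExt (fun S => gradSample f S i) x

theorem multilinearExt_add_le_of_hess_le {f : Finset N → ℝ} {x w : N → ℝ} {C : ℝ}
    (hC : ∀ s ∈ Set.Icc (0 : ℝ) 1,
      ∑ i, ∑ j, w i * w j * multilinearExt (fun S => hessSample f S i j) (x + s • w) ≤ C) :
    multilinearExt f (x + w) ≤ multilinearExt f x + w ⬝ᵥ multilinearGrad f x + C / 2 := by
  have h := le_taylor_of_deriv2_le (C := C) (hasDerivAt_multilinearExt f x w)
    (fun s => HasDerivAt.fun_sum fun i (_ : i ∈ (Finset.univ : Finset N)) =>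
      (hasDerivAt_multilinearExt_gradSample f x w i s).const_mul (w i)) ?_
  · simpa [dotProduct, multilinearGrad] using h
  · intro s hs
    simpa only [Finset.mul_sum, mul_assoc] using hC s hs

theorem le_multilinearExt_add_of_le_hess {f : Finset N → ℝ} {x w : N → ℝ} {C : ℝ}
    (hC : ∀ s ∈ Set.Icc (0 : ℝ) 1,
      -C ≤ ∑ i, ∑ j, w i * w j * multilinearExt (fun S => hessSample f S i j) (x + s • w)) :
    multilinearExt f x + w ⬝ᵥ multilinearGrad f x - C / 2 ≤ multilinearExt f (x + w) := by
  have h := le_taylor_of_deriv2_le (C := C) (fun s => (hasDerivAt_multilinearExt f x w s).fun_neg)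
    (fun s => (HasDerivAt.fun_sum fun i (_ : i ∈ (Finset.univ : Finset N)) =>
      (hasDerivAt_multilinearExt_gradSample f x w i s).const_mul (w i)).fun_neg) ?_
  · simp only [one_smul, zero_smul, add_zero] at h
    simp only [dotProduct, multilinearGrad]
    linarith
  · intro s hs
    rw [neg_le]
    simpa only [Finset.mul_sum, mul_assoc] using hC s hs

theorem IsSubmodular.hessSample_nonpos {f : Finset N → ℝ} (hf : IsSubmodular f) (S : Finset N)
    (i j : N) : hessSample f S i j ≤ 0 := by
  unfold hessSample
  split_ifs with h
  · rfl
  have := hf ((insert i S).erase j) ((insert j S).erase i)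
  have e1 : (insert i S).erase j ∪ (insert j S).erase i = insert i (insert j S) := by
    ext k
    by_cases hi : k = i <;> by_cases hj : k = j <;> simp_all
  have e2 : (insert i S).erase j ∩ (insert j S).erase i = (S.erase i).erase j := by
    ext k
    by_cases hi : k = i <;> by_cases hj : k = j <;> simp_all
  rw [e1, e2] at this
  linarith

theorem segment_mem_cube {x w : N → ℝ} (h0 : 0 ≤ x) (h1 : x ≤ 1) (hw0 : 0 ≤ x + w)
    (hw1 : x + w ≤ 1) {s : ℝ} (hs : s ∈ Set.Icc (0 : ℝ) 1) : 0 ≤ x + s • w ∧ x + s • w ≤ 1 := by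
  have e : x + s • w = (1 - s) • x + s • (x + w) := by
    ext i
    simp
    ring
  have hc := (convex_Icc (0 : N → ℝ) 1) ⟨h0, h1⟩ ⟨hw0, hw1⟩ (sub_nonneg.2 hs.2) hs.1 (by ring)
  rw [e]
  exact hc

/-- Submodularity makes the multilinear extension concave along directions of constant sign. -/
theorem IsSubmodular.multilinearExt_add_le {f : Finset N → ℝ} (hf : IsSubmodular f)
    {x w : N → ℝ} (h0 : 0 ≤ x) (h1 : x ≤ 1) (hw0 : 0 ≤ x + w) (hw1 : x + w ≤ 1)
    (hw : ∀ i j, 0 ≤ w i * w j) :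
    multilinearExt f (x + w) ≤ multilinearExt f x + w ⬝ᵥ multilinearGrad f x := by
  have h := multilinearExt_add_le_of_hess_le (f := f) (x := x) (w := w) (C := 0) ?_
  · simpa using h
  · intro s hs
    obtain ⟨hs0, hs1⟩ := segment_mem_cube h0 h1 hw0 hw1 hs
    refine Finset.sum_nonpos fun i _ => Finset.sum_nonpos fun j _ =>
      mul_nonpos_of_nonneg_of_nonpos (hw i j) ?_
    refine (multilinearExt_mono (fun S => hf.hessSample_nonpos S i j) hs0 hs1).trans_eq ?_
    exact multilinearExt_const 0 _

/-- A nonnegative submodular function loses at most the factor `1 - p` when its argument is enlarged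
by a random set whose marginals are at most `p`. -/
theorem IsSubmodular.le_multilinearExt_probSum {f : Finset N → ℝ} (hf : IsSubmodular f)
    (hf0 : ∀ S, 0 ≤ f S) {x y : N → ℝ} {p : ℝ} (hx0 : 0 ≤ x) (hxp : ∀ i, x i ≤ p) (hp0 : 0 ≤ p)
    (hp1 : p ≤ 1) (hy0 : 0 ≤ y) (hy1 : y ≤ 1) :
    (1 - p) * multilinearExt f y ≤ multilinearExt f (x + y * (1 - x)) := by
  rcases hp0.eq_or_lt with rfl | hp
  · have : x = 0 := funext fun i => le_antisymm (hxp i) (hx0 i)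
    simp [this]
  -- The probabilistic sum of `x` and `y` is `y + p • z`, and `y + z` is still in the cube because
  -- `x ≤ p`. Concavity on the segment from `y` to `y + z`, with `F(y + z) ≥ 0`, gives the claim.
  -- The concavity inequality comes from the two tangent bounds `t1`, `t2` at the intermediate
  -- point.
  set z : N → ℝ := p⁻¹ • (x * (1 - y)) with hz
  have hz0 : 0 ≤ z := fun i => by
    simp only [hz, Pi.smul_apply, Pi.mul_apply, Pi.sub_apply, Pi.one_apply, smul_eq_mul,
      Pi.zero_apply]
    exact mul_nonneg (inv_nonneg.2 hp0) (mul_nonneg (hx0 i) (sub_nonneg.2 (hy1 i)))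
  have hz1 : y + z ≤ 1 := fun i => by
    have h1 : p⁻¹ * x i ≤ 1 := by
      rw [inv_mul_le_iff₀ hp]
      simpa using hxp i
    have h2 : 0 ≤ 1 - y i := sub_nonneg.2 (hy1 i)
    have := mul_le_mul_of_nonneg_right h1 h2
    simp only [hz, Pi.add_apply, Pi.smul_apply, Pi.mul_apply, Pi.sub_apply, Pi.one_apply,
      smul_eq_mul]
    linarith
  have e : x + y * (1 - x) = y + p • z := by
    rw [hz, smul_smul, mul_inv_cancel₀ hp.ne', one_smul]
    ring
  rw [e]
  have hyz : 0 ≤ y + z := add_nonneg hy0 hz0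
  obtain ⟨hm0, hm1⟩ := segment_mem_cube hy0 hy1 hyz hz1 ⟨hp0, hp1⟩
  have e1 : y + p • z + (-p) • z = y := by simp
  have e2 : y + p • z + (1 - p) • z = y + z := by
    rw [add_assoc, ← add_smul, add_sub_cancel, one_smul]
  have t1 := hf.multilinearExt_add_le (x := y + p • z) (w := (-p) • z) hm0 hm1
    (by rwa [e1]) (by rwa [e1]) fun i j => by
      have := mul_nonneg (mul_nonneg hp0 (hz0 i)) (mul_nonneg hp0 (hz0 j))
      simpa using this
  have t2 := hf.multilinearExt_add_le (x := y + p • z) (w := (1 - p) • z) hm0 hm1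
    (by rwa [e2]) (by rwa [e2]) fun i j =>
      mul_nonneg (mul_nonneg (sub_nonneg.2 hp1) (hz0 i)) (mul_nonneg (sub_nonneg.2 hp1) (hz0 j))
  rw [e1] at t1
  rw [e2] at t2
  have hpos := multilinearExt_nonneg hf0 hyz hz1
  rw [smul_dotProduct, smul_eq_mul] at t1 t2
  nlinarith [mul_le_mul_of_nonneg_left t1 (sub_nonneg.2 hp1), mul_le_mul_of_nonneg_left t2 hp0]

theorem abs_multilinearExt_le {f : Finset N → ℝ} {B : ℝ} (h : ∀ S, |f S| ≤ B) {x : N → ℝ}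
    (h0 : 0 ≤ x) (h1 : x ≤ 1) : |multilinearExt f x| ≤ B := by
  rw [abs_le]
  constructor
  · rw [← multilinearExt_const (-B) x]
    exact multilinearExt_mono (fun S => (abs_le.1 (h S)).1) h0 h1
  · rw [← multilinearExt_const B x]
    exact multilinearExt_mono (fun S => (abs_le.1 (h S)).2) h0 h1

theorem abs_gradSample_le {f : Finset N → ℝ} {D : ℝ} (hD : ∀ S i, |f (insert i S) - f S| ≤ D)
    (S : Finset N) (i : N) : |gradSample f S i| ≤ D := by
  have := hD (S.erase i) i
  simpa [gradSample, insert_erase_self] using this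

theorem abs_hessSample_le {f : Finset N → ℝ} {D : ℝ} (hD : ∀ S i, |f (insert i S) - f S| ≤ D)
    (S : Finset N) (i j : N) : |hessSample f S i j| ≤ 2 * D := by
  rw [← gradSample_gradSample]
  have h1 := abs_gradSample_le hD (insert j S) i
  have h2 := abs_gradSample_le hD (S.erase j) i
  rw [two_mul]
  exact (abs_sub _ _).trans (add_le_add h1 h2)

theorem abs_sum_mul_le {r c : ℝ} (hc : 0 ≤ c) {w h : N → ℝ} (hh : ∀ j, |h j| ≤ c)
    (hw0 : 0 ≤ w) (hw : ∑ j, w j ≤ r) : |∑ j, h j * w j| ≤ c * r := by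
  calc |∑ j, h j * w j| ≤ ∑ j, |h j * w j| := Finset.abs_sum_le_sum_abs _ _
    _ ≤ ∑ j, c * w j := Finset.sum_le_sum fun j _ => by
        rw [abs_mul, abs_of_nonneg (hw0 j)]
        exact mul_le_mul_of_nonneg_right (hh j) (hw0 j)
    _ = c * ∑ j, w j := (Finset.mul_sum _ _ _).symm
    _ ≤ c * r := mul_le_mul_of_nonneg_left hw hc

/-- Hessian entries are at most `2D` in absolute value, so the quadratic form along `w` is at most
`2D(∑ w)²`. Measuring `w` in the `ℓ¹` norm keeps the dimension out of this term. -/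
theorem le_multilinearExt_add {f : Finset N → ℝ} {D r : ℝ} (hD0 : 0 ≤ D) (hr : 0 ≤ r)
    (hD : ∀ S i, |f (insert i S) - f S| ≤ D) {x w : N → ℝ} (h0 : 0 ≤ x) (h1 : x ≤ 1)
    (hw0 : 0 ≤ w) (hw1 : x + w ≤ 1) (hw : ∑ i, w i ≤ r) :
    multilinearExt f x + w ⬝ᵥ multilinearGrad f x - D * r ^ 2 ≤ multilinearExt f (x + w) := by
  have h := le_multilinearExt_add_of_le_hess (f := f) (x := x) (w := w) (C := 2 * D * r * r) ?_
  · linarith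
  intro s hs
  obtain ⟨hs0, hs1⟩ := segment_mem_cube h0 h1 (add_nonneg h0 hw0) hw1 hs
  refine (abs_le.1 ?_).1
  have e : ∀ i, ∑ j, w i * w j * multilinearExt (fun S => hessSample f S i j) (x + s • w) =
      (∑ j, multilinearExt (fun S => hessSample f S i j) (x + s • w) * w j) * w i := fun i => by
    rw [Finset.sum_mul]
    exact Finset.sum_congr rfl fun j _ => by ring
  simp only [e]
  refine abs_sum_mul_le (by positivity) (fun i => abs_sum_mul_le (by positivity) (fun j => ?_)
    hw0 hw) hw0 hw
  exact abs_multilinearExt_le (fun S => abs_hessSample_le hD S i j) hs0 hs1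

end Multilinear

/-! ### The feasible polytope -/

section Polytope

set_option linter.unusedSectionVars false

variable {N : Type*} [DecidableEq N] {ℐ : Finset (Finset N)}

theorem feasiblePolytope_subset_Icc : feasiblePolytope ℐ ⊆ Set.Icc 0 1 := by
  refine convexHull_min ?_ (convex_Icc _ _)
  rintro _ ⟨S, _, rfl⟩
  constructor <;> intro i <;> simp only [indicatorVec, Pi.zero_apply, Pi.one_apply] <;>
    split_ifs <;> norm_num

theorem sum_le_rank [Fintype N] {y : N → ℝ} (hy : y ∈ feasiblePolytope ℐ) :
    ∑ i, y i ≤ rank ℐ := by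
  have hlin : IsLinearMap ℝ fun y : N → ℝ => ∑ i, y i :=
    ⟨fun a b => by simp [Finset.sum_add_distrib], fun c a => by simp [Finset.mul_sum]⟩
  refine convexHull_min (t := {y : N → ℝ | ∑ i, y i ≤ rank ℐ}) ?_
    (convex_halfSpace_le hlin _) hy
  rintro _ ⟨S, hS, rfl⟩
  simp only [indicatorVec, Set.mem_ofPred_eq, Finset.sum_ite_mem, Finset.univ_inter,
    Finset.sum_const, nsmul_eq_mul, mul_one, Nat.cast_le]
  exact Finset.le_sup (f := Finset.card) hS

theorem rank_le_card [Fintype N] : rank ℐ ≤ Fintype.card N :=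
  Finset.sup_le fun S _ => Finset.card_le_univ S

/-- The product is linear in each factor, so it suffices to take `y` a generating indicator and `c`
a vertex of the cube; the product is then the indicator of a subset. -/
theorem mul_mem_feasiblePolytope [Fintype N] (hdown : ∀ A ∈ ℐ, ∀ B ⊆ A, B ∈ ℐ) {y c : N → ℝ}
    (hy : y ∈ feasiblePolytope ℐ) (hc : c ∈ Set.Icc (0 : N → ℝ) 1) :
    y * c ∈ feasiblePolytope ℐ := by
  have hcube : Set.Icc (0 : N → ℝ) 1 = convexHull ℝ (Set.univ.pi fun _ : N => {(0 : ℝ), 1}) := by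
    rw [convexHull_pi, ← Set.pi_univ_Icc]
    simp [convexHull_pair, segment_eq_Icc]
  rw [hcube] at hc
  have hconv : Convex ℝ (feasiblePolytope ℐ) := convex_convexHull _ _
  refine convexHull_min (t := {c : N → ℝ | y * c ∈ feasiblePolytope ℐ}) ?_
    (hconv.is_linear_preimage (f := fun c => y * c)
      ⟨fun a b => mul_add _ _ _, fun a b => mul_smul_comm _ _ _⟩) hc
  intro c hc
  refine convexHull_min (t := {y : N → ℝ | y * c ∈ feasiblePolytope ℐ}) ?_
    (hconv.is_linear_preimage (f := fun y => y * c)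
      ⟨fun a b => add_mul _ _ _, fun a b => smul_mul_assoc _ _ _⟩) hy
  rintro _ ⟨S, hS, rfl⟩
  refine subset_convexHull _ _ ⟨S.filter fun i => c i = 1, ?_, ?_⟩
  · exact hdown S hS _ (Finset.filter_subset _ _)
  · ext i
    rcases hc i trivial with h | h <;> simp_all [indicatorVec]

end Polytope

end StochSubmod

namespace StochSubmod

/-! ### Sampling -/

section Sampling

set_option linter.unusedSectionVars false

/-- Replaces conditioning on the past: `X` is frozen while the fresh batch `Y` is integrated out.
The `ENNReal` form needs no integrability, which is only derived later from the resulting bounds. -/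
theorem lintegral_comp_pair_of_indepFun {Ω α β : Type*} [MeasurableSpace Ω] [MeasurableSpace α]
    [MeasurableSpace β] {μ : Measure Ω} [IsProbabilityMeasure μ] {X : Ω → α} {Y : Ω → β}
    (hX : Measurable X) (hY : Measurable Y) (hXY : IndepFun X Y μ) {Φ : α → β → ENNReal}
    (hΦ : Measurable fun p : α × β => Φ p.1 p.2) :
    ∫⁻ ω, Φ (X ω) (Y ω) ∂μ = ∫⁻ ω, ∫⁻ y, Φ (X ω) y ∂μ.map Y ∂μ := by
  have hp := (indepFun_iff_map_prod_eq_prod_map_map hX.aemeasurable hY.aemeasurable).1 hXY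
  have : IsProbabilityMeasure (μ.map Y) := Measure.isProbabilityMeasure_map hY.aemeasurable
  rw [← lintegral_map hΦ (hX.prodMk hY), hp, lintegral_prod _ hΦ.aemeasurable,
    lintegral_map hΦ.lintegral_prod_right' hX]

/-- The second moment of the error of a mini-batch average around an offset `c`. -/
theorem lintegral_sq_batch_le {Ξ : Type*} [MeasurableSpace Ξ] {Q : Measure Ξ}
    [IsProbabilityMeasure Q] {h : Ξ → ℝ} (hh : MemLp h 2 Q) {V : ℝ} (hV : ∫ z, h z ^ 2 ∂Q ≤ V)
    {M : ℕ} (hM : 0 < M) (c : ℝ) :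
    ∫⁻ z : Fin M → Ξ, ENNReal.ofReal ((c + (1 / (M : ℝ)) * ∑ k, h (z k) - ∫ y, h y ∂Q) ^ 2)
      ∂Measure.pi (fun _ => Q) ≤ ENNReal.ofReal (c ^ 2 + V / M) := by
  have hM' : (M : ℝ) ≠ 0 := by positivity
  set m := ∫ y, h y ∂Q with hm
  have hk : ∀ k, MemLp (fun z : Fin M → Ξ => h (z k)) 2 (Measure.pi fun _ => Q) := fun k =>
    hh.comp_measurePreserving (measurePreserving_eval (fun _ => Q) k)
  have hsum : MemLp (fun z : Fin M → Ξ => ∑ k, h (z k)) 2 (Measure.pi fun _ => Q) :=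
    memLp_finsetSum _ fun k _ => hk k
  have hW : MemLp (fun z : Fin M → Ξ => (1 / (M : ℝ)) * ∑ k, h (z k) + (c - m)) 2
      (Measure.pi fun _ => Q) := (hsum.const_mul _).add (memLp_const _)
  have hvar : variance (fun z : Fin M → Ξ => ∑ k, h (z k)) (Measure.pi fun _ => Q) =
      M * variance h Q := by
    have := variance_sum_pi (μ := fun _ : Fin M => Q) (X := fun _ => h) fun _ => hh
    have e : (fun z : Fin M → Ξ => ∑ k, h (z k)) = ∑ k, fun z : Fin M → Ξ => h (z k) := by
      ext z
      simp
    rw [e, this]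
    simp
  have hmean : ∫ z : Fin M → Ξ, ((1 / (M : ℝ)) * ∑ k, h (z k) + (c - m))
      ∂Measure.pi (fun _ => Q) = c := by
    have hi : ∀ k, ∫ z : Fin M → Ξ, h (z k) ∂Measure.pi (fun _ => Q) = m := fun k =>
      integral_comp_eval (i := k) hh.aestronglyMeasurable
    rw [integral_add ((hsum.integrable one_le_two).const_mul _) (integrable_const _),
      integral_const_mul, integral_finsetSum _ fun k _ => (hk k).integrable one_le_two]
    simp only [hi, Finset.sum_const, Finset.card_univ, Fintype.card_fin, nsmul_eq_mul,
      integral_const, probReal_univ, one_smul]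
    field_simp
    ring
  -- The centred average has mean `c`, so its second moment is `c²` plus its variance; the cross
  -- term with the offset disappears here.
  have hvW := variance_eq_sub hW
  rw [hmean, variance_add_const (hsum.const_mul _).aestronglyMeasurable, variance_const_mul,
    hvar] at hvW
  have hvh : variance h Q ≤ V := (variance_le_expectation_sq hh.aestronglyMeasurable).trans hV
  have e : (fun z : Fin M → Ξ => ENNReal.ofReal ((c + (1 / (M : ℝ)) * ∑ k, h (z k) - m) ^ 2)) =
      fun z => ENNReal.ofReal (((1 / (M : ℝ)) * ∑ k, h (z k) + (c - m)) ^ 2) := by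
    ext z
    ring_nf
  rw [e, ← ofReal_integral_eq_lintegral_ofReal hW.integrable_sq
    (Filter.Eventually.of_forall fun z => sq_nonneg _)]
  refine ENNReal.ofReal_le_ofReal ?_
  have e2 : (1 / (M : ℝ)) ^ 2 * (M * variance h Q) = variance h Q / M := by
    field_simp
  have h3 : variance h Q / M ≤ V / M := by gcongr
  simp only [Pi.pow_apply] at hvW
  linarith

variable {N Γ : Type*} [Fintype N] [DecidableEq N] [MeasurableSpace Γ]

theorem measurableSet_bernoulliSet_eq {α : Type*} [MeasurableSpace α] {z : α → N → ℝ}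
    {u : α → N → unitInterval} (hz : Measurable z) (hu : Measurable u) (S : Finset N) :
    MeasurableSet {a | bernoulliSet (z a) (u a) = S} := by
  have : {a | bernoulliSet (z a) (u a) = S} = ⋂ i, {a | ((u a i : ℝ) < z a i ↔ i ∈ S)} := by
    ext a
    simp [Finset.ext_iff, bernoulliSet]
  rw [this]
  refine MeasurableSet.iInter fun i => ?_
  have hlt : MeasurableSet {a | (u a i : ℝ) < z a i} :=
    measurableSet_lt (by fun_prop) (by fun_prop)
  by_cases hi : i ∈ S
  · simpa [hi] using hlt
  · have : {a | ((u a i : ℝ) < z a i ↔ i ∈ S)} = {a | (u a i : ℝ) < z a i}ᶜ := by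
      ext a
      simp [hi]
    rw [this]
    exact hlt.compl

/-- A sum over the finitely many values of `β` reduces joint measurability to the level sets of `β`.
-/
theorem measurable_apply_finset {α : Type*} [MeasurableSpace α] {φ : Γ → Finset N → ℝ}
    (hφ : ∀ S, Measurable fun γ => φ γ S) {c : α → Γ} (hc : Measurable c) {β : α → Finset N}
    (hβ : ∀ S, MeasurableSet {a | β a = S}) : Measurable fun a => φ (c a) (β a) := by
  have : (fun a => φ (c a) (β a)) = fun a => ∑ S, {a | β a = S}.indicator (fun a => φ (c a) S) a := by
    ext a
    simp [Set.indicator_apply]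
  rw [this]
  exact Finset.measurable_fun_sum _ fun S _ => ((hφ S).comp hc).indicator (hβ S)

theorem measure_bernoulliSet_eq {x : N → ℝ} (h0 : 0 ≤ x) (h1 : x ≤ 1) (S : Finset N) :
    (Measure.pi fun _ : N => (volume : Measure unitInterval)).real {u | bernoulliSet x u = S} =
      bernoulliWeight x S := by
  have e : {u | bernoulliSet x u = S} = Set.univ.pi fun i =>
      if i ∈ S then Set.Iio (⟨x i, h0 i, h1 i⟩ : unitInterval) else Set.Ici ⟨x i, h0 i, h1 i⟩ := by
    ext u
    simp only [Finset.ext_iff, bernoulliSet, Finset.mem_filter, Finset.mem_univ, true_and,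
      Set.mem_ofPred_eq, Set.mem_pi, Set.mem_univ, true_imp_iff]
    refine forall_congr' fun i => ?_
    by_cases hi : i ∈ S
    · simp [hi, ← Subtype.coe_lt_coe]
    · simp [hi, ← Subtype.coe_le_coe]
  rw [Measure.real, e, Measure.pi_pi, ENNReal.toReal_prod, bernoulliWeight_eq_prod]
  refine Finset.prod_congr rfl fun i _ => ?_
  split_ifs
  · simp [ENNReal.toReal_ofReal (h0 i)]
  · have : (0 : ℝ) ≤ 1 - x i := sub_nonneg.2 (h1 i)
    simp [ENNReal.toReal_ofReal this]

theorem integral_bernoulliSet (f : Finset N → ℝ) {x : N → ℝ} (h0 : 0 ≤ x) (h1 : x ≤ 1) :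
    ∫ u, f (bernoulliSet x u) ∂Measure.pi (fun _ : N => (volume : Measure unitInterval)) =
      multilinearExt f x := by
  have hm : ∀ S, MeasurableSet {u : N → unitInterval | bernoulliSet x u = S} := fun S =>
    measurableSet_bernoulliSet_eq measurable_const measurable_id S
  have : (fun u => f (bernoulliSet x u)) = fun u : N → unitInterval =>
      ∑ S, {u : N → unitInterval | bernoulliSet x u = S}.indicator (fun _ => f S) u := by
    ext u
    simp [Set.indicator_apply]
  rw [this, integral_finsetSum _ fun S _ => (integrable_const _).indicator (hm S),
    multilinearExt_eq_sum_weight]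
  refine Finset.sum_congr rfl fun S _ => ?_
  rw [integral_indicator_const _ (hm S), measure_bernoulliSet_eq h0 h1, smul_eq_mul, mul_comm]

theorem maxMarginal_nonneg (f : Finset N → ℝ) : 0 ≤ maxMarginal f :=
  Real.iSup_nonneg fun _ => abs_nonneg _

theorem abs_marginal_le_maxMarginal (f : Finset N → ℝ) (S : Finset N) (i : N) :
    |f (insert i S) - f S| ≤ maxMarginal f :=
  le_ciSup (f := fun p : Finset N × N => |f (insert p.2 p.1) - f p.1|)
    (Set.finite_range _).bddAbove (S, i)

variable {P : Measure Γ} [IsProbabilityMeasure P] {fγ : Γ → Finset N → ℝ}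

theorem marginalBound_nonneg : 0 ≤ marginalBound P fγ := Real.sqrt_nonneg _

theorem marginalBound_sq :
    marginalBound P fγ ^ 2 = ∫ γ, maxMarginal (fγ γ) ^ 2 ∂P :=
  Real.sq_sqrt (integral_nonneg fun _ => sq_nonneg _)

theorem abs_marginal_meanFun_le (hint : ∀ S, Integrable (fun γ => fγ γ S) P)
    (hmarg : MemLp (fun γ => maxMarginal (fγ γ)) 2 P) (S : Finset N) (i : N) :
    |meanFun P fγ (insert i S) - meanFun P fγ S| ≤ marginalBound P fγ := by
  have hi : Integrable (fun γ => maxMarginal (fγ γ)) P := hmarg.integrable one_le_two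
  calc |meanFun P fγ (insert i S) - meanFun P fγ S|
      = |∫ γ, (fγ γ (insert i S) - fγ γ S) ∂P| := by
        rw [integral_sub (hint _) (hint _)]
        rfl
    _ ≤ ∫ γ, |fγ γ (insert i S) - fγ γ S| ∂P := abs_integral_le_integral_abs
    _ ≤ ∫ γ, maxMarginal (fγ γ) ∂P :=
        integral_mono ((hint _).sub (hint _)).abs hi fun γ => abs_marginal_le_maxMarginal _ _ _
    _ ≤ marginalBound P fγ := by
        refine Real.le_sqrt_of_sq_le ?_
        -- `(E D_γ)² ≤ E[D_γ²]`.
        have := variance_nonneg (fun γ => maxMarginal (fγ γ)) P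
        rw [variance_eq_sub hmarg] at this
        simpa using this

theorem meanFun_gradSample (hint : ∀ S, Integrable (fun γ => fγ γ S) P) (i : N) :
    meanFun P (fun γ S => gradSample (fγ γ) S i) = fun S => gradSample (meanFun P fγ) S i := by
  ext S
  exact integral_sub (hint _) (hint _)

theorem integrable_gradSample (hint : ∀ S, Integrable (fun γ => fγ γ S) P) (i : N) (S : Finset N) :
    Integrable (fun γ => gradSample (fγ γ) S i) P :=
  (hint _).sub (hint _)

theorem meanFun_hessSample (hint : ∀ S, Integrable (fun γ => fγ γ S) P) (i j : N) :
    meanFun P (fun γ S => hessSample (fγ γ) S i j) =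
      fun S => hessSample (meanFun P fγ) S i j := by
  simp only [← gradSample_gradSample]
  rw [meanFun_gradSample (integrable_gradSample hint i) j, meanFun_gradSample hint i]

theorem integrable_hessSample (hint : ∀ S, Integrable (fun γ => fγ γ S) P) (i j : N)
    (S : Finset N) : Integrable (fun γ => hessSample (fγ γ) S i j) P := by
  simp only [← gradSample_gradSample]
  exact integrable_gradSample (integrable_gradSample hint i) j S

theorem measurable_gradSample (hmeas : ∀ S, Measurable fun γ => fγ γ S) (i : N) (S : Finset N) :
    Measurable (fun γ => gradSample (fγ γ) S i) :=
  (hmeas _).sub (hmeas _)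

theorem measurable_hessSample (hmeas : ∀ S, Measurable fun γ => fγ γ S) (i j : N)
    (S : Finset N) : Measurable (fun γ => hessSample (fγ γ) S i j) := by
  simp only [← gradSample_gradSample]
  exact measurable_gradSample (measurable_gradSample hmeas i) j S

/-- The error of a mini-batch average of samples `φ γ (β y)` that are dominated by the maximal
marginal return. -/
theorem lintegral_sq_batch_le_marginalBound {Y : Type*} [MeasurableSpace Y] {ν : Measure Y}
    [IsProbabilityMeasure ν] (hmarg : MemLp (fun γ => maxMarginal (fγ γ)) 2 P)
    {φ : Γ → Finset N → ℝ} (hφ : ∀ S, Measurable fun γ => φ γ S) {C : ℝ}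
    (hC : ∀ γ S, |φ γ S| ≤ C * maxMarginal (fγ γ)) {β : Y → Finset N}
    (hβ : ∀ S, MeasurableSet {y | β y = S}) {M : ℕ} (hM : 0 < M) (c : ℝ) :
    ∫⁻ z : Fin M → Γ × Y, ENNReal.ofReal ((c + (1 / (M : ℝ)) * ∑ k, φ (z k).1 (β (z k).2) -
      ∫ y, meanFun P φ (β y) ∂ν) ^ 2) ∂Measure.pi (fun _ => P.prod ν) ≤
      ENNReal.ofReal (c ^ 2 + C ^ 2 * marginalBound P fγ ^ 2 / M) := by
  have hmeas : Measurable fun p : Γ × Y => φ p.1 (β p.2) :=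
    measurable_apply_finset hφ measurable_fst (β := fun p : Γ × Y => β p.2)
      fun S => measurable_snd (hβ S)
  have hdom : MemLp (fun p : Γ × Y => C * maxMarginal (fγ p.1)) 2 (P.prod ν) :=
    (hmarg.comp_fst ν).const_mul C
  have hL : MemLp (fun p : Γ × Y => φ p.1 (β p.2)) 2 (P.prod ν) :=
    hdom.mono hmeas.aestronglyMeasurable (Filter.Eventually.of_forall fun p =>
      (hC p.1 _).trans (le_abs_self _))
  have hmean : ∫ y, meanFun P φ (β y) ∂ν = ∫ p, φ p.1 (β p.2) ∂P.prod ν := by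
    rw [integral_prod_symm _ (hL.integrable one_le_two)]
    rfl
  rw [hmean]
  refine lintegral_sq_batch_le hL ?_ hM c
  rw [marginalBound_sq]
  calc ∫ p, φ p.1 (β p.2) ^ 2 ∂P.prod ν ≤ ∫ p, (C * maxMarginal (fγ p.1)) ^ 2 ∂P.prod ν :=
        integral_mono hL.integrable_sq hdom.integrable_sq fun p =>
          sq_le_sq.2 ((hC p.1 _).trans (le_abs_self _))
    _ = C ^ 2 * ∫ γ, maxMarginal (fγ γ) ^ 2 ∂P := by
        simp only [mul_pow]
        rw [integral_const_mul, integral_fun_fst (f := fun γ => maxMarginal (fγ γ) ^ 2)]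
        simp

theorem multilinearExt_sum_mul (h : N → Finset N → ℝ) (w x : N → ℝ) :
    multilinearExt (fun S => ∑ j, h j S * w j) x = ∑ j, w j * multilinearExt (h j) x := by
  simp only [multilinearExt_eq_sum_weight, Finset.sum_mul, Finset.mul_sum]
  rw [Finset.sum_comm]
  exact Finset.sum_congr rfl fun j _ => Finset.sum_congr rfl fun S _ => by ring

theorem integral_unitInterval (g : ℝ → ℝ) :
    ∫ a : unitInterval, g a = ∫ a in (0 : ℝ)..1, g a := by
  rw [intervalIntegral.integral_of_le zero_le_one, ← integral_Icc_eq_integral_Ioc,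
    ← unitInterval.measurePreserving_coe.integral_comp unitInterval.measurableEmbedding_coe]

theorem measurableSet_bernoulliSet_segment_eq (x x' : N → ℝ) (S : Finset N) :
    MeasurableSet {p : unitInterval × (N → unitInterval) |
      bernoulliSet ((p.1 : ℝ) • x + (1 - (p.1 : ℝ)) • x') p.2 = S} := by
  refine measurableSet_bernoulliSet_eq ?_ measurable_snd S
  have : Measurable fun p : unitInterval × (N → unitInterval) => (p.1 : ℝ) :=
    measurable_subtype_coe.comp measurable_fst
  exact (this.smul_const x).add ((this.const_sub 1).smul_const x')

/-- The Hessian samples on a segment are unbiased for the difference of the gradients. -/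
theorem integral_hess_segment (f : Finset N → ℝ) {x x' : N → ℝ} (hx0 : 0 ≤ x) (hx1 : x ≤ 1)
    (hx'0 : 0 ≤ x') (hx'1 : x' ≤ 1) (i : N) :
    ∫ p : unitInterval × (N → unitInterval),
      ∑ j, hessSample f (bernoulliSet ((p.1 : ℝ) • x + (1 - (p.1 : ℝ)) • x') p.2) i j *
        (x - x') j ∂(volume.prod (Measure.pi fun _ => volume)) =
      multilinearGrad f x i - multilinearGrad f x' i := by
  set w := x - x' with hw
  set h : Finset N → ℝ := fun S => ∑ j, hessSample f S i j * w j with hh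
  have hm := measurableSet_bernoulliSet_segment_eq x x'
  have hint : Integrable (fun p : unitInterval × (N → unitInterval) =>
      h (bernoulliSet ((p.1 : ℝ) • x + (1 - (p.1 : ℝ)) • x') p.2))
      (volume.prod (Measure.pi fun _ => volume)) := by
    have hme := measurable_apply_finset (φ := fun _ : unitInterval × (N → unitInterval) => h)
      (fun S => measurable_const) measurable_id hm
    refine Integrable.of_bound hme.aestronglyMeasurable (∑ S, |h S|)
      (Filter.Eventually.of_forall fun p => ?_)
    exact Finset.single_le_sum (f := fun S => |h S|) (fun S _ => abs_nonneg _)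
      (Finset.mem_univ _)
  rw [integral_prod _ hint]
  have e : ∀ a : unitInterval, ∫ u : N → unitInterval,
      h (bernoulliSet ((a : ℝ) • x + (1 - (a : ℝ)) • x') u) ∂(Measure.pi fun _ => volume) =
      ∑ j, w j * multilinearExt (fun S => hessSample f S i j) (x' + (a : ℝ) • w) := fun a => by
    have e1 : (a : ℝ) • x + (1 - (a : ℝ)) • x' = x' + (a : ℝ) • w := by
      ext k
      simp [hw]
      ring
    have hxw : x' + w = x := by simp [hw]
    obtain ⟨hs0, hs1⟩ := segment_mem_cube hx'0 hx'1 (by rwa [hxw]) (by rwa [hxw]) a.2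
    rw [e1, integral_bernoulliSet h hs0 hs1, hh, multilinearExt_sum_mul]
  simp only [e]
  -- After averaging over `u`, the integrand is the derivative in `a` of `∂F/∂x_i` along the
  -- segment; the uniform average over `a` is the fundamental theorem of calculus.
  rw [integral_unitInterval fun a =>
    ∑ j, w j * multilinearExt (fun S => hessSample f S i j) (x' + a • w),
    intervalIntegral.integral_eq_sub_of_hasDerivAt
      (fun s _ => hasDerivAt_multilinearExt_gradSample f x' w i s)]
  · simp [multilinearGrad, hw]
  · refine Continuous.intervalIntegrable ?_ _ _
    have := fun j => continuous_multilinearExt fun S => hessSample f S i j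
    fun_prop

end Sampling

end StochSubmod

namespace StochSubmod

/-! ### One step of the greedy method -/

section Step

set_option linter.unusedSectionVars false

variable {N : Type*} [Fintype N] [DecidableEq N]

theorem dotProduct_le_of_pos {a b : N → ℝ} {α : ℝ} (hα : 0 < α) :
    a ⬝ᵥ b ≤ α / 2 * ∑ i, a i ^ 2 + (∑ i, b i ^ 2) / (2 * α) := by
  rw [dotProduct, Finset.mul_sum, Finset.sum_div, ← Finset.sum_add_distrib]
  refine Finset.sum_le_sum fun i _ => ?_
  have h : α / 2 * a i ^ 2 + b i ^ 2 / (2 * α) - a i * b i = (α * a i - b i) ^ 2 / (2 * α) := by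
    field_simp
    ring
  have : 0 ≤ (α * a i - b i) ^ 2 / (2 * α) := by positivity
  linarith

/-- The progress of one step of the measured greedy method with an inexact gradient `g`. -/
theorem IsSubmodular.greedy_step_le {f : Finset N → ℝ} (hf : IsSubmodular f)
    (hf0 : ∀ S, 0 ≤ f S) {D : ℝ} (hD0 : 0 ≤ D) (hD : ∀ S i, |f (insert i S) - f S| ≤ D)
    {ℐ : Finset (Finset N)} (hdown : ∀ A ∈ ℐ, ∀ B ⊆ A, B ∈ ℐ) {x v g y : N → ℝ} {p α τ : ℝ}
    (hx0 : 0 ≤ x) (hxp : ∀ i, x i ≤ p) (hp0 : 0 ≤ p) (hp1 : p ≤ 1)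
    (hv : v ∈ feasiblePolytope ℐ) (hvx : v ≤ 1 - x)
    (hmax : ∀ w ∈ feasiblePolytope ℐ, w ≤ 1 - x → w ⬝ᵥ g ≤ v ⬝ᵥ g)
    (hy : y ∈ feasiblePolytope ℐ) (hα : 0 < α) (hτ0 : 0 ≤ τ) (hτ1 : τ ≤ 1) :
    multilinearExt f x + τ * ((1 - p) * multilinearExt f y - multilinearExt f x - α * rank ℐ -
      (∑ i, (g i - multilinearGrad f x i) ^ 2) / (2 * α)) - D * (τ * rank ℐ) ^ 2 ≤
      multilinearExt f (x + τ • v) := by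
  have hx1 : x ≤ 1 := fun i => (hxp i).trans hp1
  obtain ⟨hv0, hv1⟩ := feasiblePolytope_subset_Icc hv
  obtain ⟨hy0, hy1⟩ := feasiblePolytope_subset_Icc hy
  -- The competitor to `v`: shrinking `y` by `1 - x` makes it admissible, and `x + w` is the
  -- probabilistic sum of `x` and `y`.
  set w : N → ℝ := y * (1 - x) with hw
  have hc : (1 - x) ∈ Set.Icc (0 : N → ℝ) 1 := ⟨sub_nonneg.2 hx1, sub_le_self _ hx0⟩
  have hwC : w ∈ feasiblePolytope ℐ := mul_mem_feasiblePolytope hdown hy hc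
  obtain ⟨hw0, hw1⟩ := feasiblePolytope_subset_Icc hwC
  have hwx : w ≤ 1 - x := fun i => mul_le_of_le_one_left (hc.1 i) (hy1 i)
  have hxw1 : x + w ≤ 1 := by
    have := add_le_add_right hwx x
    simpa using this
  have hvs := sum_le_rank hv
  have hws := sum_le_rank hwC
  have hr : (0 : ℝ) ≤ rank ℐ := Nat.cast_nonneg _
  have h1 : (1 - p) * multilinearExt f y ≤ multilinearExt f (x + w) :=
    hf.le_multilinearExt_probSum hf0 hx0 hxp hp0 hp1 hy0 hy1
  have h2 := hf.multilinearExt_add_le hx0 hx1 (add_nonneg hx0 hw0) hxw1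
    fun i j => mul_nonneg (hw0 i) (hw0 j)
  have h3 := hmax w hwC hwx
  have h4 := dotProduct_le_of_pos (a := w - v) (b := multilinearGrad f x - g) hα
  -- For entries in `[0, 1]`, `(w - v)² ≤ w + v`, so the squared distance is controlled by the rank
  -- instead of the dimension.
  have h5 : ∑ i, (w - v) i ^ 2 ≤ 2 * rank ℐ := by
    calc ∑ i, (w - v) i ^ 2 ≤ ∑ i, (w i + v i) := Finset.sum_le_sum fun i _ => by
          have a0 := hw0 i
          have a1 := hw1 i
          have b0 := hv0 i
          have b1 := hv1 i
          simp only [Pi.zero_apply, Pi.one_apply, Pi.sub_apply] at *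
          nlinarith [mul_nonneg a0 b0, mul_nonneg a0 (sub_nonneg.2 a1),
            mul_nonneg b0 (sub_nonneg.2 b1)]
      _ = ∑ i, w i + ∑ i, v i := Finset.sum_add_distrib
      _ ≤ 2 * rank ℐ := by linarith
  have h6 : α / 2 * ∑ i, (w - v) i ^ 2 ≤ α * rank ℐ := by
    have := mul_le_mul_of_nonneg_left h5 (half_pos hα).le
    linarith
  have e7 : ∑ i, (multilinearGrad f x - g) i ^ 2 = ∑ i, (g i - multilinearGrad f x i) ^ 2 :=
    Finset.sum_congr rfl fun i _ => by
      rw [Pi.sub_apply]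
      ring
  rw [e7, sub_dotProduct, dotProduct_sub, dotProduct_sub] at h4
  have h8 := le_multilinearExt_add (f := f) (D := D) (r := τ * rank ℐ) (x := x) (w := τ • v) hD0
    (mul_nonneg hτ0 hr) hD hx0 hx1 (smul_nonneg hτ0 hv0) (fun i => ?_) ?_
  · rw [smul_dotProduct, smul_eq_mul] at h8
    have h9 : (1 - p) * multilinearExt f y - multilinearExt f x - α * rank ℐ -
        (∑ i, (g i - multilinearGrad f x i) ^ 2) / (2 * α) ≤ v ⬝ᵥ multilinearGrad f x := by
      linarith
    have := mul_le_mul_of_nonneg_left h9 hτ0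
    linarith
  · have a := mul_le_of_le_one_left (hv0 i) hτ1
    have b := hvx i
    simp only [Pi.add_apply, Pi.smul_apply, Pi.sub_apply, Pi.one_apply, smul_eq_mul] at *
    linarith
  · simp only [Pi.smul_apply, smul_eq_mul, ← Finset.mul_sum]
    exact mul_le_mul_of_nonneg_left hvs hτ0

end Step

/-! ### Numerical facts -/

section Numeric

theorem le_of_greedy_recursion {T : ℕ} (hT : 1 ≤ T) {a : ℕ → ℝ} {Y A B : ℝ} (h0 : 0 ≤ a 0)
    (hrec : ∀ t < T, (1 - 1 / (T : ℝ)) * a t +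
      1 / T * ((1 - 1 / (T : ℝ)) ^ t * Y - (A + B * (t / T))) ≤ a (t + 1)) :
    (1 - 1 / (T : ℝ)) ^ (T - 1) * Y -
      (A * (1 - (1 - 1 / (T : ℝ)) ^ T) + B * (1 - 1 / (T : ℝ)) ^ T) ≤ a T := by
  have hT0 : (0 : ℝ) < T := by exact_mod_cast hT
  have hT1 : (1 : ℝ) ≤ T := by exact_mod_cast hT
  set q : ℝ := 1 - 1 / (T : ℝ) with hq
  have hq0 : 0 ≤ q := by
    rw [hq, sub_nonneg, div_le_one hT0]
    exact hT1
  -- Exact solution of the recursion with equality and `a 0 = 0`, using `1/T = 1 - q`. At `n = 0`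
  -- the truncated exponent is harmless, being multiplied by `0`.
  have key : ∀ n ≤ T, n / T * q ^ (n - 1) * Y - (A * (1 - q ^ n) + B * (n / T - (1 - q ^ n))) ≤
      a n := by
    intro n
    induction n with
    | zero => intro _; simpa using h0
    | succ n ih =>
      intro hn
      have h1 := hrec n (by omega)
      have h2 := mul_le_mul_of_nonneg_left (ih (by omega)) hq0
      have e : q * ((n : ℝ) / T * q ^ (n - 1)) = n / T * q ^ n := by
        rcases n with _ | n
        · simp
        · rw [Nat.add_sub_cancel, pow_succ]
          ring
      have e1 : 1 / (T : ℝ) = 1 - q := by rw [hq]; ring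
      refine le_trans (le_of_eq ?_) ((add_le_add_left h2 _).trans h1)
      rw [Nat.add_sub_cancel, pow_succ]
      have e2 : ((n + 1 : ℕ) : ℝ) / T = n / T + (1 - q) := by
        rw [← e1]
        push_cast
        ring
      rw [e2, e1]
      linear_combination (-Y) * e
  have h := key T le_rfl
  rw [div_self hT0.ne'] at h
  linarith

theorem exp_neg_one_le_pow {T : ℕ} (hT : 1 ≤ T) :
    Real.exp (-1) ≤ (1 - 1 / (T : ℝ)) ^ (T - 1) := by
  obtain ⟨n, rfl⟩ := Nat.exists_eq_add_of_le' hT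
  rcases n.eq_zero_or_pos with rfl | hn
  · simp
  have hn0 : (0 : ℝ) < n := by exact_mod_cast hn
  have e : 1 - 1 / ((n + 1 : ℕ) : ℝ) = (1 + 1 / (n : ℝ))⁻¹ := by
    push_cast
    field_simp
    ring
  rw [Nat.add_sub_cancel, e, inv_pow, Real.exp_neg]
  refine inv_anti₀ (by positivity) ?_
  have h := Real.add_one_le_exp (1 / (n : ℝ))
  calc (1 + 1 / (n : ℝ)) ^ n ≤ Real.exp (1 / n) ^ n :=
        pow_le_pow_left₀ (by positivity) (by linarith) n
    _ = Real.exp 1 := by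
        rw [← Real.exp_nat_mul]
        field_simp

/-- Bernoulli's inequality with real exponent `T/2 ≥ 1` gives `1/2`; squaring gives `1/4`. -/
theorem quarter_le_pow {T : ℕ} (hT : 2 ≤ T) : 1 / 4 ≤ (1 - 1 / (T : ℝ)) ^ T := by
  have hT2 : (2 : ℝ) ≤ T := by exact_mod_cast hT
  have hT0 : (0 : ℝ) < T := by linarith
  have hle : 1 / (T : ℝ) ≤ 1 := by
    rw [div_le_one hT0]
    linarith
  have h := one_add_mul_self_le_rpow_one_add (s := -(1 / (T : ℝ))) (p := (T : ℝ) / 2)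
    (by linarith) (by linarith)
  have e : 1 + (T : ℝ) / 2 * -(1 / T) = 1 / 2 := by
    field_simp
    norm_num
  rw [e, ← sub_eq_add_neg] at h
  have hq : 0 ≤ 1 - 1 / (T : ℝ) := by linarith
  have h2 : (1 - 1 / (T : ℝ)) ^ T = ((1 - 1 / (T : ℝ)) ^ ((T : ℝ) / 2)) ^ 2 := by
    rw [← Real.rpow_natCast, ← Real.rpow_natCast, ← Real.rpow_mul hq]
    norm_num
  rw [h2]
  nlinarith

end Numeric

/-! ### The run -/

section Run

set_option linter.unusedSectionVars false

variable {N Γ Ω : Type*} [Fintype N] [DecidableEq N] [MeasurableSpace Γ]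

theorem measurable_batchGrad {fγ : Γ → Finset N → ℝ} (hmeas : ∀ S, Measurable fun γ => fγ γ S)
    {M₀ : ℕ} (x : N → ℝ) :
    Measurable fun z : Fin M₀ → Γ × (N → unitInterval) => batchGrad fγ z x := by
  refine measurable_pi_iff.2 fun i => Measurable.const_mul ?_ _
  refine Finset.measurable_fun_sum _ fun k _ => ?_
  exact measurable_apply_finset (φ := fun γ S => gradSample (fγ γ) S i)
    (measurable_gradSample hmeas i) (by fun_prop)
    (measurableSet_bernoulliSet_eq measurable_const (by fun_prop))

theorem measurable_batchHess {fγ : Γ → Finset N → ℝ} (hmeas : ∀ S, Measurable fun γ => fγ γ S)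
    {M : ℕ} (i j : N) :
    Measurable fun p : ((N → ℝ) × (N → ℝ)) × (Fin M → Γ × unitInterval × (N → unitInterval)) =>
      batchHess fγ p.2 p.1.1 p.1.2 i j := by
  refine Measurable.const_mul (Finset.measurable_fun_sum _ fun k _ => ?_) _
  refine measurable_apply_finset (φ := fun γ S => hessSample (fγ γ) S i j)
    (measurable_hessSample hmeas i j) (by fun_prop)
    (measurableSet_bernoulliSet_eq ?_ (by fun_prop))
  have : Measurable fun p : ((N → ℝ) × (N → ℝ)) × (Fin M → Γ × unitInterval × (N → unitInterval)) =>
      ((p.2 k).2.1 : ℝ) := by fun_prop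
  exact (this.smul (by fun_prop)).add ((this.const_sub 1).smul (by fun_prop))

theorem measurable_batchHess_mulVec {fγ : Γ → Finset N → ℝ}
    (hmeas : ∀ S, Measurable fun γ => fγ γ S) {M : ℕ} (i : N) :
    Measurable fun p : ((N → ℝ) × (N → ℝ)) × (Fin M → Γ × unitInterval × (N → unitInterval)) =>
      (batchHess fγ p.2 p.1.1 p.1.2).mulVec (p.1.1 - p.1.2) i := by
  refine Finset.measurable_fun_sum _ fun j _ => (measurable_batchHess hmeas i j).mul ?_
  have : Measurable fun p : ((N → ℝ) × (N → ℝ)) ×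
      (Fin M → Γ × unitInterval × (N → unitInterval)) => p.1.1 j - p.1.2 j := by fun_prop
  exact this

theorem batchHess_mulVec (fγ : Γ → Finset N → ℝ) {M : ℕ}
    (z : Fin M → Γ × unitInterval × (N → unitInterval)) (x x' w : N → ℝ) (i : N) :
    (batchHess fγ z x x').mulVec w i = (1 / (M : ℝ)) * ∑ k, ∑ j, hessSample (fγ (z k).1)
      (bernoulliSet (((z k).2.1 : ℝ) • x + (1 - ((z k).2.1 : ℝ)) • x') (z k).2.2) i j * w j := by
  simp only [Matrix.mulVec, dotProduct, batchHess, Finset.mul_sum, Finset.sum_mul]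
  rw [Finset.sum_comm]
  exact Finset.sum_congr rfl fun k _ => Finset.sum_congr rfl fun j _ => by ring

theorem measurable_multilinearGrad (f : Finset N → ℝ) (i : N) :
    Measurable fun x => multilinearGrad f x i :=
  (continuous_multilinearExt _).measurable

/-- The second moment of the error of the updated gradient estimator, for fixed iterates. -/
theorem lintegral_sq_hess_update_le {P : Measure Γ} [IsProbabilityMeasure P]
    {fγ : Γ → Finset N → ℝ} (hmeas : ∀ S, Measurable fun γ => fγ γ S)
    (hint : ∀ S, Integrable (fun γ => fγ γ S) P)
    (hmarg : MemLp (fun γ => maxMarginal (fγ γ)) 2 P) {x x' : N → ℝ} {ρ : ℝ} (hx0 : 0 ≤ x)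
    (hx1 : x ≤ 1) (hx'0 : 0 ≤ x') (hx'1 : x' ≤ 1) (hw0 : 0 ≤ x - x')
    (hw : ∑ j, (x - x') j ≤ ρ) {M : ℕ} (hM : 0 < M) (e : ℝ) (i : N) :
    ∫⁻ z : Fin M → Γ × unitInterval × (N → unitInterval),
      ENNReal.ofReal ((e + (batchHess fγ z x x').mulVec (x - x') i -
        (multilinearGrad (meanFun P fγ) x i - multilinearGrad (meanFun P fγ) x' i)) ^ 2)
      ∂Measure.pi (fun _ => P.prod (volume.prod (Measure.pi fun _ => volume))) ≤
      ENNReal.ofReal (e ^ 2 + (2 * ρ) ^ 2 * marginalBound P fγ ^ 2 / M) := by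
  simp only [batchHess_mulVec]
  rw [← integral_hess_segment (meanFun P fγ) hx0 hx1 hx'0 hx'1 i]
  have hmean : meanFun P (fun γ S => ∑ j, hessSample (fγ γ) S i j * (x - x') j) =
      fun S => ∑ j, hessSample (meanFun P fγ) S i j * (x - x') j := by
    ext S
    rw [meanFun, integral_finsetSum _ fun j _ => (integrable_hessSample hint i j S).mul_const _]
    refine Finset.sum_congr rfl fun j _ => ?_
    rw [integral_mul_const]
    exact congrArg (· * (x - x') j) (congrFun (meanFun_hessSample hint i j) S)
  have h := lintegral_sq_batch_le_marginalBound (P := P) (fγ := fγ)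
    (ν := volume.prod (Measure.pi fun _ => volume)) hmarg
    (φ := fun γ S => ∑ j, hessSample (fγ γ) S i j * (x - x') j) (C := 2 * ρ)
    (fun S => Finset.measurable_fun_sum _ fun j _ => (measurable_hessSample hmeas i j S).mul_const _)
    (fun γ S => ?_) (measurableSet_bernoulliSet_segment_eq x x') hM e
  · rw [hmean] at h
    exact h
  · have := abs_sum_mul_le (mul_nonneg zero_le_two (maxMarginal_nonneg (fγ γ)))
      (fun j => abs_hessSample_le (abs_marginal_le_maxMarginal (fγ γ)) S i j) hw0 hw
    linarith

theorem lintegral_sq_batchGrad_le {P : Measure Γ} [IsProbabilityMeasure P]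
    {fγ : Γ → Finset N → ℝ} (hmeas : ∀ S, Measurable fun γ => fγ γ S)
    (hint : ∀ S, Integrable (fun γ => fγ γ S) P)
    (hmarg : MemLp (fun γ => maxMarginal (fγ γ)) 2 P) {x : N → ℝ} (hx0 : 0 ≤ x) (hx1 : x ≤ 1)
    {M₀ : ℕ} (hM : 0 < M₀) (i : N) :
    ∫⁻ z : Fin M₀ → Γ × (N → unitInterval),
      ENNReal.ofReal ((batchGrad fγ z x i - multilinearGrad (meanFun P fγ) x i) ^ 2)
      ∂Measure.pi (fun _ => P.prod (Measure.pi fun _ => volume)) ≤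
      ENNReal.ofReal (marginalBound P fγ ^ 2 / M₀) := by
  have h := lintegral_sq_batch_le_marginalBound (P := P) (fγ := fγ)
    (ν := Measure.pi fun _ => volume) hmarg
    (φ := fun γ S => gradSample (fγ γ) S i) (C := 1) (measurable_gradSample hmeas i)
    (fun γ S => ?_) (measurableSet_bernoulliSet_eq (measurable_const (a := x))
      measurable_id') hM 0
  · rw [meanFun_gradSample hint,
      integral_bernoulliSet (fun S => gradSample (meanFun P fγ) S i) hx0 hx1] at h
    simp only [zero_add, one_pow, one_mul, zero_pow two_ne_zero] at h
    exact h
  · rw [one_mul]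
    exact abs_gradSample_le (abs_marginal_le_maxMarginal (fγ γ)) S i

variable [mΩ : MeasurableSpace Ω] {P : Measure Γ} {μ : Measure Ω} {fγ : Γ → Finset N → ℝ}
  {ℐ : Finset (Finset N)} {T M₀ M : ℕ} {ℱ : Filtration ℕ mΩ}
  {ξ₀ : Fin M₀ → Ω → Γ × (N → unitInterval)}
  {ξ : ℕ → Fin M → Ω → Γ × unitInterval × (N → unitInterval)} {x g v : ℕ → Ω → N → ℝ}

theorem IsMeasuredRun.x_nonneg (hrun : IsMeasuredRun P fγ ℐ T M₀ M μ ℱ ξ₀ ξ x g v) {t : ℕ}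
    (ht : t ≤ T) (ω : Ω) : 0 ≤ x t ω := by
  induction t with
  | zero => rw [hrun.x_zero]
  | succ t ih =>
    rw [hrun.x_succ t ht]
    exact add_nonneg (ih (by omega))
      (smul_nonneg (by positivity) (feasiblePolytope_subset_Icc (hrun.v_mem t ht ω).1).1)

/-- From `v ≤ 1 - x`, the gap `1 - x` shrinks by at most the factor `1 - 1/T` per round. -/
theorem IsMeasuredRun.x_le (hrun : IsMeasuredRun P fγ ℐ T M₀ M μ ℱ ξ₀ ξ x g v) (hT : 1 ≤ T)
    {t : ℕ} (ht : t ≤ T) (ω : Ω) (i : N) : x t ω i ≤ 1 - (1 - 1 / (T : ℝ)) ^ t := by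
  induction t with
  | zero => simp [hrun.x_zero]
  | succ t ih =>
    have h1 := ih (by omega)
    have h2 := (hrun.v_mem t ht ω).2 i
    have hT1 : 1 / (T : ℝ) ≤ 1 := by
      rw [div_le_one (by positivity)]
      exact_mod_cast hT
    have h3 := mul_le_mul_of_nonneg_left h2 (by positivity : 0 ≤ 1 / (T : ℝ))
    have h4 := mul_le_mul_of_nonneg_left h1 (sub_nonneg.2 hT1)
    rw [hrun.x_succ t ht, pow_succ]
    simp only [Pi.add_apply, Pi.smul_apply, Pi.sub_apply, Pi.one_apply, smul_eq_mul] at *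
    linarith

theorem one_sub_inv_mem_Icc (hT : 1 ≤ T) : 1 - 1 / (T : ℝ) ∈ Set.Icc (0 : ℝ) 1 := by
  have : 1 / (T : ℝ) ≤ 1 := by
    rw [div_le_one (by positivity)]
    exact_mod_cast hT
  have h0 : 0 ≤ 1 / (T : ℝ) := by positivity
  constructor <;> linarith

theorem IsMeasuredRun.x_le_one (hrun : IsMeasuredRun P fγ ℐ T M₀ M μ ℱ ξ₀ ξ x g v) (hT : 1 ≤ T)
    {t : ℕ} (ht : t ≤ T) (ω : Ω) : x t ω ≤ 1 := fun i =>
  (hrun.x_le hT ht ω i).trans (sub_le_self _ (pow_nonneg (one_sub_inv_mem_Icc hT).1 _))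

theorem IsMeasuredRun.measurable_x (hrun : IsMeasuredRun P fγ ℐ T M₀ M μ ℱ ξ₀ ξ x g v) {t : ℕ}
    (ht : t ≤ T) : Measurable[ℱ t] (x t) := by
  induction t with
  | zero =>
    have : x 0 = fun _ => 0 := funext hrun.x_zero
    rw [this]
    exact measurable_const
  | succ t ih =>
    have : x (t + 1) = fun ω => x t ω + (1 / (T : ℝ)) • v t ω := funext (hrun.x_succ t ht)
    rw [this]
    exact ((ih (by omega)).add ((hrun.v_meas t ht).fun_const_smul (1 / (T : ℝ)))).mono
      (ℱ.mono (Nat.le_succ t)) le_rfl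

/-- The next iterate is already known at time `t`, so batch `t + 1` is independent of both ends of
its segment. -/
theorem IsMeasuredRun.measurable_x_succ (hrun : IsMeasuredRun P fγ ℐ T M₀ M μ ℱ ξ₀ ξ x g v)
    {t : ℕ} (ht : t < T) : Measurable[ℱ t] (x (t + 1)) := by
  have : x (t + 1) = fun ω => x t ω + (1 / (T : ℝ)) • v t ω := funext (hrun.x_succ t ht)
  rw [this]
  exact (hrun.measurable_x ht.le).add ((hrun.v_meas t ht).fun_const_smul (1 / (T : ℝ)))

theorem IsMeasuredRun.measurable_g (hrun : IsMeasuredRun P fγ ℐ T M₀ M μ ℱ ξ₀ ξ x g v)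
    (hmeas : ∀ S, Measurable fun γ => fγ γ S) {t : ℕ} (ht : t < T) : Measurable[ℱ t] (g t) := by
  induction t with
  | zero =>
    have : g 0 = (fun z => batchGrad fγ z 0) ∘ fun ω k => ξ₀ k ω := by
      ext1 ω
      rw [hrun.g_zero, hrun.x_zero]
      rfl
    rw [this]
    exact (measurable_batchGrad hmeas 0).comp
      (@measurable_pi_lambda _ _ _ (ℱ 0) _ _ fun k => hrun.seed_zero_meas k)
  | succ t ih =>
    refine @measurable_pi_lambda _ _ _ (ℱ (t + 1)) _ _ fun i => ?_
    have e : (fun ω => g (t + 1) ω i) = fun ω => g t ω i +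
        (fun p : ((N → ℝ) × (N → ℝ)) × (Fin M → Γ × unitInterval × (N → unitInterval)) =>
          (batchHess fγ p.2 p.1.1 p.1.2).mulVec (p.1.1 - p.1.2) i)
          ((x (t + 1) ω, x t ω), fun k => ξ (t + 1) k ω) := by
      ext ω
      rw [hrun.g_succ t ht]
      rfl
    have hm : ℱ t ≤ ℱ (t + 1) := ℱ.mono (Nat.le_succ t)
    have h1 : Measurable[ℱ (t + 1)] fun ω => g t ω i :=
      (measurable_pi_apply i).comp ((ih (by omega)).mono hm le_rfl)
    have h2 : Measurable[ℱ (t + 1)] fun ω => ((x (t + 1) ω, x t ω), fun k => ξ (t + 1) k ω) :=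
      ((hrun.measurable_x ht.le).prodMk
        ((hrun.measurable_x (by omega : t ≤ T)).mono hm le_rfl)).prodMk
        (@measurable_pi_lambda _ _ _ (ℱ (t + 1)) _ _ fun k => hrun.seed_meas t ht k)
    rw [e]
    exact h1.add ((measurable_batchHess_mulVec hmeas i).comp h2)

theorem IsMeasuredRun.measurable_gradErr
    (hrun : IsMeasuredRun P fγ ℐ T M₀ M μ ℱ ξ₀ ξ x g v)
    (hmeas : ∀ S, Measurable fun γ => fγ γ S) {t : ℕ} (ht : t < T) (i : N) :
    Measurable[ℱ t] fun ω => g t ω i - multilinearGrad (meanFun P fγ) (x t ω) i :=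
  ((measurable_pi_apply i).comp (hrun.measurable_g hmeas ht)).sub
    ((measurable_multilinearGrad _ i).comp (hrun.measurable_x ht.le))

variable [IsProbabilityMeasure P] [IsProbabilityMeasure μ]

theorem IsMeasuredRun.lintegral_gradErr_zero_le
    (hrun : IsMeasuredRun P fγ ℐ T M₀ M μ ℱ ξ₀ ξ x g v)
    (hmeas : ∀ S, Measurable fun γ => fγ γ S) (hint : ∀ S, Integrable (fun γ => fγ γ S) P)
    (hmarg : MemLp (fun γ => maxMarginal (fγ γ)) 2 P) (hM₀ : 0 < M₀) (i : N) :
    ∫⁻ ω, ENNReal.ofReal ((g 0 ω i - multilinearGrad (meanFun P fγ) (x 0 ω) i) ^ 2) ∂μ ≤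
      ENNReal.ofReal (marginalBound P fγ ^ 2 / M₀) := by
  have hseed : ∀ k, Measurable (ξ₀ k) := fun k => (hrun.seed_zero_meas k).mono (ℱ.le 0) le_rfl
  have hlaw : μ.map (fun ω k => ξ₀ k ω) =
      Measure.pi fun _ : Fin M₀ => P.prod (Measure.pi fun _ => volume) := by
    rw [(iIndepFun_iff_map_fun_eq_pi_map fun k => (hseed k).aemeasurable).1 hrun.seed_zero_indep]
    simp only [hrun.seed_zero_law]
  have h := lintegral_sq_batchGrad_le hmeas hint hmarg (x := 0) le_rfl zero_le_one hM₀ i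
  have hm : Measurable fun z : Fin M₀ → Γ × (N → unitInterval) =>
      ENNReal.ofReal ((batchGrad fγ z 0 i - multilinearGrad (meanFun P fγ) 0 i) ^ 2) :=
    ((((measurable_pi_apply i).comp (measurable_batchGrad hmeas 0)).sub_const _).pow_const
      2).ennreal_ofReal
  rw [← hlaw, lintegral_map hm (measurable_pi_lambda _ hseed)] at h
  simpa only [hrun.g_zero, hrun.x_zero] using h

/-- Given the past, the new error is the old one plus a centred batch average, so the squares add. A
sample is at most `2 D_γ` times the `ℓ¹` length of the step, which is at most `r/T`. -/
theorem IsMeasuredRun.lintegral_gradErr_succ_le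
    (hrun : IsMeasuredRun P fγ ℐ T M₀ M μ ℱ ξ₀ ξ x g v)
    (hmeas : ∀ S, Measurable fun γ => fγ γ S) (hint : ∀ S, Integrable (fun γ => fγ γ S) P)
    (hmarg : MemLp (fun γ => maxMarginal (fγ γ)) 2 P) (hM : 0 < M) {t : ℕ} (ht : t + 1 < T)
    (i : N) :
    ∫⁻ ω, ENNReal.ofReal
      ((g (t + 1) ω i - multilinearGrad (meanFun P fγ) (x (t + 1) ω) i) ^ 2) ∂μ ≤
      ∫⁻ ω, ENNReal.ofReal ((g t ω i - multilinearGrad (meanFun P fγ) (x t ω) i) ^ 2) ∂μ +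
      ENNReal.ofReal ((2 * (rank ℐ / T)) ^ 2 * marginalBound P fγ ^ 2 / M) := by
  have hT : 1 ≤ T := by omega
  have hseed : ∀ k, Measurable (ξ (t + 1) k) := fun k =>
    (hrun.seed_meas t ht k).mono (ℱ.le _) le_rfl
  have hlaw : μ.map (fun ω k => ξ (t + 1) k ω) =
      Measure.pi fun _ : Fin M => P.prod (volume.prod (Measure.pi fun _ => volume)) := by
    rw [(iIndepFun_iff_map_fun_eq_pi_map fun k => (hseed k).aemeasurable).1 (hrun.seed_indep t ht)]
    simp only [hrun.seed_law t ht]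
  set e : Ω → ℝ := fun ω => g t ω i - multilinearGrad (meanFun P fγ) (x t ω) i with he
  have heM := hrun.measurable_gradErr hmeas (by omega : t < T) i
  have hX : Measurable[ℱ t] fun ω => ((x (t + 1) ω, x t ω), e ω) :=
    ((hrun.measurable_x_succ (by omega)).prodMk (hrun.measurable_x (by omega))).prodMk heM
  have hind : IndepFun (fun ω => ((x (t + 1) ω, x t ω), e ω)) (fun ω k => ξ (t + 1) k ω) μ := by
    rw [IndepFun_iff_Indep]
    refine (indep_of_indep_of_le_left (indep_of_indep_of_le_right
      (hrun.seed_fresh t ht) hX.comap_le) ?_).symm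
    rw [MeasurableSpace.pi, MeasurableSpace.comap_iSup]
    refine iSup_mono fun k => ?_
    rw [MeasurableSpace.comap_comp]
    rfl
  -- The squared new error as a function of the past state (two iterates and the old error) and of
  -- the fresh batch.
  set Φ : ((N → ℝ) × (N → ℝ)) × ℝ → (Fin M → Γ × unitInterval × (N → unitInterval)) → ENNReal :=
    fun s z => ENNReal.ofReal ((s.2 + (batchHess fγ z s.1.1 s.1.2).mulVec (s.1.1 - s.1.2) i -
      (multilinearGrad (meanFun P fγ) s.1.1 i - multilinearGrad (meanFun P fγ) s.1.2 i)) ^ 2)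
    with hΦ
  have hΦm : Measurable fun p : (((N → ℝ) × (N → ℝ)) × ℝ) ×
      (Fin M → Γ × unitInterval × (N → unitInterval)) => Φ p.1 p.2 := by
    have h1 : Measurable fun p : (((N → ℝ) × (N → ℝ)) × ℝ) ×
        (Fin M → Γ × unitInterval × (N → unitInterval)) => (p.1.1, p.2) := by fun_prop
    have h2 := (measurable_batchHess_mulVec (M := M) hmeas i).comp h1
    have h3 := measurable_multilinearGrad (meanFun P fγ) i
    refine Measurable.ennreal_ofReal (Measurable.pow_const ?_ 2)
    exact ((by fun_prop : Measurable fun p : (((N → ℝ) × (N → ℝ)) × ℝ) ×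
      (Fin M → Γ × unitInterval × (N → unitInterval)) => p.1.2).add h2).sub
      ((h3.comp (by fun_prop)).sub (h3.comp (by fun_prop)))
  have hpair := lintegral_comp_pair_of_indepFun (hX.mono (ℱ.le t) le_rfl)
    (measurable_pi_lambda _ hseed) hind hΦm
  calc ∫⁻ ω, ENNReal.ofReal
        ((g (t + 1) ω i - multilinearGrad (meanFun P fγ) (x (t + 1) ω) i) ^ 2) ∂μ
      = ∫⁻ ω, Φ ((x (t + 1) ω, x t ω), e ω) (fun k => ξ (t + 1) k ω) ∂μ := by
        refine lintegral_congr fun ω => ?_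
        rw [hrun.g_succ t ht]
        simp only [hΦ, he, Pi.add_apply]
        ring_nf
    _ = ∫⁻ ω, ∫⁻ z, Φ ((x (t + 1) ω, x t ω), e ω) z ∂μ.map (fun ω k => ξ (t + 1) k ω) ∂μ := hpair
    _ ≤ ∫⁻ ω, (ENNReal.ofReal (e ω ^ 2) +
          ENNReal.ofReal ((2 * (rank ℐ / T)) ^ 2 * marginalBound P fγ ^ 2 / M)) ∂μ := by
        refine lintegral_mono fun ω => ?_
        have hd : x (t + 1) ω - x t ω = (1 / (T : ℝ)) • v t ω := by
          rw [hrun.x_succ t (by omega), add_sub_cancel_left]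
        have hv := (hrun.v_mem t (by omega) ω).1
        have hsum : ∑ j, (x (t + 1) ω - x t ω) j ≤ rank ℐ / T := by
          rw [hd]
          simp only [Pi.smul_apply, smul_eq_mul, ← Finset.mul_sum]
          rw [one_div, inv_mul_eq_div]
          exact div_le_div_of_nonneg_right (sum_le_rank hv) (by positivity)
        rw [hlaw, ← ENNReal.ofReal_add (sq_nonneg _) (by positivity)]
        exact lintegral_sq_hess_update_le hmeas hint hmarg
          (hrun.x_nonneg ht.le ω) (hrun.x_le_one hT ht.le ω) (hrun.x_nonneg (by omega) ω)
          (hrun.x_le_one hT (by omega) ω)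
          (hd ▸ smul_nonneg (by positivity) (feasiblePolytope_subset_Icc hv).1) hsum hM _ i
    _ = _ := by
        rw [lintegral_add_right _ measurable_const]
        simp [he]

theorem IsMeasuredRun.lintegral_gradErr_le
    (hrun : IsMeasuredRun P fγ ℐ T M₀ M μ ℱ ξ₀ ξ x g v)
    (hmeas : ∀ S, Measurable fun γ => fγ γ S) (hint : ∀ S, Integrable (fun γ => fγ γ S) P)
    (hmarg : MemLp (fun γ => maxMarginal (fγ γ)) 2 P) (hM₀ : 0 < M₀) (hM : 0 < M) {t : ℕ}
    (ht : t < T) (i : N) :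
    ∫⁻ ω, ENNReal.ofReal ((g t ω i - multilinearGrad (meanFun P fγ) (x t ω) i) ^ 2) ∂μ ≤
      ENNReal.ofReal (marginalBound P fγ ^ 2 / M₀ +
        t * ((2 * (rank ℐ / T)) ^ 2 * marginalBound P fγ ^ 2 / M)) := by
  induction t with
  | zero => simpa using hrun.lintegral_gradErr_zero_le hmeas hint hmarg hM₀ i
  | succ t ih =>
    refine (hrun.lintegral_gradErr_succ_le hmeas hint hmarg hM ht i).trans
      ((add_le_add_left (ih (by omega)) _).trans_eq ?_)
    rw [← ENNReal.ofReal_add (by positivity) (by positivity)]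
    push_cast
    ring_nf

theorem IsMeasuredRun.integrable_sq_gradErr
    (hrun : IsMeasuredRun P fγ ℐ T M₀ M μ ℱ ξ₀ ξ x g v)
    (hmeas : ∀ S, Measurable fun γ => fγ γ S) (hint : ∀ S, Integrable (fun γ => fγ γ S) P)
    (hmarg : MemLp (fun γ => maxMarginal (fγ γ)) 2 P) (hM₀ : 0 < M₀) (hM : 0 < M) {t : ℕ}
    (ht : t < T) (i : N) :
    Integrable (fun ω => (g t ω i - multilinearGrad (meanFun P fγ) (x t ω) i) ^ 2) μ := by
  have hm := ((hrun.measurable_gradErr hmeas ht i).mono (ℱ.le t) le_rfl).pow_const 2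
  refine ⟨hm.aestronglyMeasurable, ?_⟩
  rw [hasFiniteIntegral_iff_ofReal (Filter.Eventually.of_forall fun _ => sq_nonneg _)]
  exact (hrun.lintegral_gradErr_le hmeas hint hmarg hM₀ hM ht i).trans_lt ENNReal.ofReal_lt_top

theorem IsMeasuredRun.integral_sq_gradErr_le
    (hrun : IsMeasuredRun P fγ ℐ T M₀ M μ ℱ ξ₀ ξ x g v)
    (hmeas : ∀ S, Measurable fun γ => fγ γ S) (hint : ∀ S, Integrable (fun γ => fγ γ S) P)
    (hmarg : MemLp (fun γ => maxMarginal (fγ γ)) 2 P) (hM₀ : 0 < M₀) (hM : 0 < M) {t : ℕ}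
    (ht : t < T) (i : N) :
    ∫ ω, (g t ω i - multilinearGrad (meanFun P fγ) (x t ω) i) ^ 2 ∂μ ≤
      marginalBound P fγ ^ 2 / M₀ + t * ((2 * (rank ℐ / T)) ^ 2 * marginalBound P fγ ^ 2 / M) := by
  have h := hrun.lintegral_gradErr_le hmeas hint hmarg hM₀ hM ht i
  rw [← ofReal_integral_eq_lintegral_ofReal
    (hrun.integrable_sq_gradErr hmeas hint hmarg hM₀ hM ht i)
    (Filter.Eventually.of_forall fun _ => sq_nonneg _)] at h
  exact (ENNReal.ofReal_le_ofReal_iff (by positivity)).1 h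

theorem IsMeasuredRun.integrable_multilinearExt
    (hrun : IsMeasuredRun P fγ ℐ T M₀ M μ ℱ ξ₀ ξ x g v) (hT : 1 ≤ T) (f : Finset N → ℝ) {t : ℕ}
    (ht : t ≤ T) : Integrable (fun ω => multilinearExt f (x t ω)) μ := by
  refine Integrable.of_bound ((continuous_multilinearExt f).measurable.comp
    ((hrun.measurable_x ht).mono (ℱ.le t) le_rfl)).aestronglyMeasurable (∑ S, |f S|)
    (Filter.Eventually.of_forall fun ω => ?_)
  exact abs_multilinearExt_le (fun S => Finset.single_le_sum (f := fun S => |f S|)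
    (fun S _ => abs_nonneg _) (Finset.mem_univ S)) (hrun.x_nonneg ht ω) (hrun.x_le_one hT ht ω)

/-- The recursion for the expected value along a run. -/
theorem IsMeasuredRun.integral_multilinearExt_succ_ge
    (hrun : IsMeasuredRun P fγ ℐ T M₀ M μ ℱ ξ₀ ξ x g v)
    (hmeas : ∀ S, Measurable fun γ => fγ γ S) (hint : ∀ S, Integrable (fun γ => fγ γ S) P)
    (hnonneg : ∀ S, 0 ≤ meanFun P fγ S) (hsub : IsSubmodular (meanFun P fγ))
    (hmarg : MemLp (fun γ => maxMarginal (fγ γ)) 2 P)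
    (hdown : ∀ A ∈ ℐ, ∀ B ⊆ A, B ∈ ℐ) (hT : 1 ≤ T) (hM₀ : 0 < M₀) (hM : 0 < M)
    {y : N → ℝ} (hy : y ∈ feasiblePolytope ℐ) {α : ℝ} (hα : 0 < α) {t : ℕ} (ht : t < T) :
    (1 - 1 / (T : ℝ)) * ∫ ω, multilinearExt (meanFun P fγ) (x t ω) ∂μ +
      1 / T * ((1 - 1 / (T : ℝ)) ^ t * multilinearExt (meanFun P fγ) y -
        (α * rank ℐ + Fintype.card N * (marginalBound P fγ ^ 2 / M₀ +
          t * ((2 * (rank ℐ / T)) ^ 2 * marginalBound P fγ ^ 2 / M)) / (2 * α) +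
          marginalBound P fγ * rank ℐ ^ 2 / T)) ≤
      ∫ ω, multilinearExt (meanFun P fγ) (x (t + 1) ω) ∂μ := by
  set f := meanFun P fγ with hf
  set D := marginalBound P fγ with hD
  set Y := multilinearExt f y with hY
  obtain ⟨hq0, hq1⟩ := one_sub_inv_mem_Icc hT
  set q : ℝ := 1 - 1 / (T : ℝ) with hq
  have hFi := hrun.integrable_multilinearExt hT f ht.le
  have hEi := fun i => hrun.integrable_sq_gradErr hmeas hint hmarg hM₀ hM ht i
  have hSi : Integrable (fun ω => ∑ i, (g t ω i - multilinearGrad f (x t ω) i) ^ 2) μ :=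
    integrable_finsetSum _ fun i _ => hEi i
  have hS : ∫ ω, ∑ i, (g t ω i - multilinearGrad f (x t ω) i) ^ 2 ∂μ ≤
      Fintype.card N * (D ^ 2 / M₀ + t * ((2 * (rank ℐ / T)) ^ 2 * D ^ 2 / M)) := by
    rw [integral_finsetSum _ fun i _ => hEi i]
    refine (Finset.sum_le_sum fun i _ =>
      hrun.integral_sq_gradErr_le hmeas hint hmarg hM₀ hM ht i).trans_eq ?_
    rw [Finset.sum_const, Finset.card_univ, nsmul_eq_mul]
  have hstep : ∀ ω, q * multilinearExt f (x t ω) - (1 / T * (1 / (2 * α))) *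
      ∑ i, (g t ω i - multilinearGrad f (x t ω) i) ^ 2 +
      (1 / T * (q ^ t * Y - α * rank ℐ) - D * (1 / T * rank ℐ) ^ 2) ≤
      multilinearExt f (x (t + 1) ω) := by
    intro ω
    -- Applied with `p = 1 - q ^ t`, the coordinate bound on the iterate, so that `1 - p = q ^ t`.
    have h := hsub.greedy_step_le hnonneg (marginalBound_nonneg (P := P) (fγ := fγ))
      (abs_marginal_meanFun_le hint hmarg) hdown (hrun.x_nonneg ht.le ω)
      (hrun.x_le hT ht.le ω) (sub_nonneg.2 (pow_le_one₀ hq0 hq1))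
      (sub_le_self _ (pow_nonneg hq0 _)) (hrun.v_mem t ht ω).1 (hrun.v_mem t ht ω).2
      (hrun.v_max t ht ω) hy hα (τ := 1 / (T : ℝ)) (by positivity) (by linarith)
    rw [← hrun.x_succ t ht] at h
    refine le_trans (le_of_eq ?_) h
    rw [hq, hf, hY, hD]
    ring
  have hmono := integral_mono ((((hFi.const_mul q).sub (hSi.const_mul _))).add
    (integrable_const _)) (hrun.integrable_multilinearExt hT f (Nat.succ_le_of_lt ht)) hstep
  rw [integral_add' ((hFi.const_mul q).sub (hSi.const_mul _)) (integrable_const _),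
    integral_sub' (hFi.const_mul q) (hSi.const_mul _), integral_const_mul, integral_const_mul,
    integral_const, probReal_univ, one_smul] at hmono
  have hc : 0 ≤ 1 / (T : ℝ) * (1 / (2 * α)) := by positivity
  have hS' := mul_le_mul_of_nonneg_left hS hc
  refine le_trans ?_ hmono
  refine le_trans (le_of_eq ?_) (add_le_add_left (sub_le_sub_left hS' _) _)
  ring

end Run

end StochSubmod

namespace StochSubmod

/-! ### Choice of the Young parameter and assembly of the bound -/

section Final

/-- The error terms of the greedy recursion for the optimal Young parameter. -/
theorem exists_young_param {T M₀ M : ℕ} {r d D D' q : ℝ} (hT : 1 ≤ T) (hM : 2 * (T : ℝ) ≤ M)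
    (hM₀ : (T : ℝ) ^ 2 / (2 * r ^ 2) ≤ M₀) (hM₀pos : 0 < M₀) (hr : 1 ≤ r) (hrd : r ≤ d)
    (hD : 0 ≤ D) (hDD' : D ≤ D') (hD' : 0 < D') (hq : q = (1 - 1 / (T : ℝ)) ^ T) :
    ∃ α > 0, ∃ A B : ℝ, (∀ t : ℕ, α * r + d * (D ^ 2 / M₀ +
      t * ((2 * (r / T)) ^ 2 * D ^ 2 / M)) / (2 * α) + D * r ^ 2 / T ≤ A + B * (t / T)) ∧
      A * (1 - q) + B * q ≤ 2.5 * √(r ^ 3 * d) * D' / T := by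
  have hr0 : 0 < r := by linarith
  have hd0 : 0 < d := by linarith
  have hTpos : (0 : ℝ) < T := by exact_mod_cast hT
  have hMpos : (0 : ℝ) < M := by linarith
  have hM₀' : (0 : ℝ) < M₀ := by exact_mod_cast hM₀pos
  have hM₀1 : (1 : ℝ) ≤ M₀ := by exact_mod_cast hM₀pos
  set κ := √(r * d) with hκ
  have hκ2 : κ ^ 2 = r * d := Real.sq_sqrt (by positivity)
  have hκ0 : 0 < κ := Real.sqrt_pos.2 (by positivity)
  have hrκ : r ≤ κ := Real.le_sqrt_of_sq_le (by nlinarith)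
  have hK : √(r ^ 3 * d) = r * κ := by
    rw [show r ^ 3 * d = r ^ 2 * (r * d) by ring, Real.sqrt_mul (sq_nonneg r),
      Real.sqrt_sq hr0.le]
  have hd : d = κ ^ 2 / r := by
    rw [hκ2]
    field_simp
  have hDsq : D ^ 2 ≤ D' ^ 2 := pow_le_pow_left₀ hD hDD' 2
  have hu1 : (2 * (r / T)) ^ 2 * D ^ 2 / M ≤ 2 * r ^ 2 * D' ^ 2 / T ^ 3 := by
    calc (2 * (r / T)) ^ 2 * D ^ 2 / M ≤ (2 * (r / T)) ^ 2 * D' ^ 2 / (2 * T) := by gcongr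
      _ = 2 * r ^ 2 * D' ^ 2 / T ^ 3 := by
        field_simp
  have hs : D * r ^ 2 / T ≤ r * κ * D' / T := by
    have : D * r ^ 2 ≤ r * κ * D' := by
      calc D * r ^ 2 ≤ D' * r ^ 2 := by gcongr
        _ = r * r * D' := by ring
        _ ≤ r * κ * D' := by gcongr
    gcongr
  rw [hK]
  rcases hT.eq_or_lt with rfl | hT2
  -- For `T = 1` one has `q = 0`, so `B` is irrelevant. The bound `M₀ ≥ 1` suffices, and the Young,
  -- variance and curvature terms give `1 + 1/2 + 1 = 2.5`.
  · refine ⟨κ * D', by positivity, 2.5 * (r * κ * D'), d * (2 * r ^ 2 * D' ^ 2) / (2 * (κ * D')),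
      fun t => ?_, ?_⟩
    · have hu0 : D ^ 2 / M₀ ≤ D' ^ 2 := (div_le_self (sq_nonneg _) hM₀1).trans hDsq
      have h1 : d * D' ^ 2 / (2 * (κ * D')) ≤ r * κ * D' / 2 := by
        rw [hd, div_le_div_iff₀ (by positivity) two_pos]
        have : κ ^ 2 / r ≤ κ ^ 2 * r := by
          rw [div_le_iff₀ hr0]
          nlinarith [sq_nonneg κ, mul_pos (pow_pos hκ0 2) hr0]
        nlinarith [mul_le_mul_of_nonneg_right this (sq_nonneg D')]
      have h2 : d * (D ^ 2 / M₀ + t * ((2 * (r / (1 : ℕ))) ^ 2 * D ^ 2 / M)) / (2 * (κ * D')) ≤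
          d * (D' ^ 2 + t * (2 * r ^ 2 * D' ^ 2 / (1 : ℕ) ^ 3)) / (2 * (κ * D')) := by gcongr
      have h3 : d * (D' ^ 2 + t * (2 * r ^ 2 * D' ^ 2 / (1 : ℕ) ^ 3)) / (2 * (κ * D')) =
          d * D' ^ 2 / (2 * (κ * D')) +
            d * (2 * r ^ 2 * D' ^ 2) / (2 * (κ * D')) * (t / (1 : ℕ)) := by
        simp only [Nat.cast_one, one_pow, div_one]
        ring
      simp only [Nat.cast_one, div_one] at *
      linarith
    · simp at hq
      rw [hq]
      simp
      linarith
  · have hu0 : D ^ 2 / M₀ ≤ 2 * r ^ 2 * D' ^ 2 / T ^ 2 := by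
      calc D ^ 2 / M₀ ≤ D' ^ 2 / ((T : ℝ) ^ 2 / (2 * r ^ 2)) := by gcongr
        _ = 2 * r ^ 2 * D' ^ 2 / T ^ 2 := by
          field_simp
    set E := r * κ * D' / T with hE
    have hE0 : 0 ≤ E := by positivity
    -- In units of `E`: the Young term is `5/4`, the initial variance `4/5`, the curvature `1`, so
    -- `A = 3.05`; the accumulated variance gives `B = 4/5`. Since `q ≥ 1/4`, `3.05 - 2.25 q ≤
    -- 2.4875 < 2.5`.
    refine ⟨5 / 4 * κ * D' / T, by positivity, 3.05 * E, 0.8 * E, fun t => ?_, ?_⟩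
    · have h2 : d * (D ^ 2 / M₀ + t * ((2 * (r / T)) ^ 2 * D ^ 2 / M)) /
          (2 * (5 / 4 * κ * D' / T)) ≤
          d * (2 * r ^ 2 * D' ^ 2 / T ^ 2 + t * (2 * r ^ 2 * D' ^ 2 / T ^ 3)) /
          (2 * (5 / 4 * κ * D' / T)) := by gcongr
      have h3 : d * (2 * r ^ 2 * D' ^ 2 / T ^ 2 + t * (2 * r ^ 2 * D' ^ 2 / T ^ 3)) /
          (2 * (5 / 4 * κ * D' / T)) = 4 / 5 * E + 4 / 5 * E * (t / T) := by
        rw [hd, hE]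
        field_simp
      have h4 : 5 / 4 * κ * D' / T * r = 5 / 4 * E := by
        rw [hE]
        ring
      rw [h4]
      linarith
    · have hq4 := quarter_le_pow hT2
      rw [← hq] at hq4
      have e : 2.5 * (r * κ) * D' / T = 2.5 * E := by
        rw [hE]
        ring
      rw [e]
      nlinarith [mul_le_mul_of_nonneg_left hq4 hE0]

end Final

end StochSubmod

-- The strict majorant `D'` of `D_f` keeps the Young parameter positive even when `D_f = 0`.
-- Positive rank makes the condition on `M₀` force a nonempty initial batch.
open StochSubmod in
theorem StochSubmod.le_integral_of_rank_pos {N Γ Ω : Type*} [Fintype N] [DecidableEq N]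
    [MeasurableSpace Γ] [mΩ : MeasurableSpace Ω] {P : Measure Γ} [IsProbabilityMeasure P]
    {μ : Measure Ω} [IsProbabilityMeasure μ] {fγ : Γ → Finset N → ℝ}
    {ℐ : Finset (Finset N)} {T M₀ M : ℕ} {ℱ : Filtration ℕ mΩ}
    {ξ₀ : Fin M₀ → Ω → Γ × (N → unitInterval)}
    {ξ : ℕ → Fin M → Ω → Γ × unitInterval × (N → unitInterval)} {x g v : ℕ → Ω → N → ℝ}
    (hrun : IsMeasuredRun P fγ ℐ T M₀ M μ ℱ ξ₀ ξ x g v)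
    (hmeas : ∀ S, Measurable fun γ => fγ γ S) (hint : ∀ S, Integrable (fun γ => fγ γ S) P)
    (hnonneg : ∀ S, 0 ≤ meanFun P fγ S) (hsub : IsSubmodular (meanFun P fγ))
    (hmarg : MemLp (fun γ => maxMarginal (fγ γ)) 2 P)
    (hdown : ∀ A ∈ ℐ, ∀ B ⊆ A, B ∈ ℐ) (hT : 1 ≤ T) (hM : 2 * (T : ℝ) ≤ M)
    (hM₀ : (T : ℝ) ^ 2 / (2 * (rank ℐ : ℝ) ^ 2) ≤ M₀) (hr : 1 ≤ rank ℐ)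
    {y : N → ℝ} (hy : y ∈ feasiblePolytope ℐ) {D' : ℝ} (hD' : marginalBound P fγ < D') :
    Real.exp (-1) * multilinearExt (meanFun P fγ) y -
      2.5 * √((rank ℐ : ℝ) ^ 3 * (Fintype.card N : ℝ)) * D' / T ≤
      ∫ ω, multilinearExt (meanFun P fγ) (x T ω) ∂μ := by
  have hTpos : (0 : ℝ) < T := by exact_mod_cast hT
  have hr1 : (1 : ℝ) ≤ rank ℐ := by exact_mod_cast hr
  have hM₀pos : 0 < M₀ := by
    have : (0 : ℝ) < M₀ := lt_of_lt_of_le (by positivity) hM₀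
    exact_mod_cast this
  have hMpos : 0 < M := by
    have : (0 : ℝ) < M := by linarith
    exact_mod_cast this
  have hD0 := marginalBound_nonneg (P := P) (fγ := fγ)
  obtain ⟨α, hα, A, B, hAB, hfin⟩ := exists_young_param hT hM hM₀ hM₀pos hr1
    (Nat.cast_le.2 (rank_le_card (ℐ := ℐ))) hD0 hD'.le (hD0.trans_lt hD') rfl
  obtain ⟨hy0, hy1⟩ := feasiblePolytope_subset_Icc hy
  have hY := multilinearExt_nonneg hnonneg hy0 hy1
  have hrec := le_of_greedy_recursion hT
    (a := fun t => ∫ ω, multilinearExt (meanFun P fγ) (x t ω) ∂μ)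
    (Y := multilinearExt (meanFun P fγ) y) (A := A) (B := B) ?_ ?_
  · have h1 := mul_le_mul_of_nonneg_right (exp_neg_one_le_pow hT) hY
    linarith
  · exact integral_nonneg fun ω => multilinearExt_nonneg hnonneg (hrun.x_nonneg (Nat.zero_le _) ω)
      (hrun.x_le_one hT (Nat.zero_le _) ω)
  · intro t ht
    refine le_trans ?_ (hrun.integral_multilinearExt_succ_ge hmeas hint hnonneg hsub hmarg hdown
      hT hM₀pos hMpos hy hα ht)
    have h1 := mul_le_mul_of_nonneg_left (hAB t) (by positivity : 0 ≤ 1 / (T : ℝ))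
    linarith

theorem mainTheorem6 {N Γ Ω : Type*} [Fintype N] [DecidableEq N] [MeasurableSpace Γ]
    [mΩ : MeasurableSpace Ω] (P : Measure Γ) [IsProbabilityMeasure P]
    (μ : Measure Ω) [IsProbabilityMeasure μ]
    (fγ : Γ → Finset N → ℝ)
    (hmeas : ∀ S, Measurable fun γ => fγ γ S)
    (hint : ∀ S, Integrable (fun γ => fγ γ S) P)
    (hnonneg : ∀ S, 0 ≤ StochSubmod.meanFun P fγ S)
    (hsub : StochSubmod.IsSubmodular (StochSubmod.meanFun P fγ))
    (hmarg : MemLp (fun γ => StochSubmod.maxMarginal (fγ γ)) 2 P)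
    (ℐ : Finset (Finset N)) (hempty : ∅ ∈ ℐ) (hdown : ∀ A ∈ ℐ, ∀ B ⊆ A, B ∈ ℐ)
    (T M₀ M : ℕ) (hT : 1 ≤ T)
    (hM : 2 * (T : ℝ) ≤ M)
    (hM₀ : (T : ℝ) ^ 2 / (2 * (StochSubmod.rank ℐ : ℝ) ^ 2) ≤ M₀)
    (ℱ : Filtration ℕ mΩ)
    (ξ₀ : Fin M₀ → Ω → Γ × (N → unitInterval))
    (ξ : ℕ → Fin M → Ω → Γ × unitInterval × (N → unitInterval))
    (x g v : ℕ → Ω → N → ℝ)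
    (hrun : StochSubmod.IsMeasuredRun P fγ ℐ T M₀ M μ ℱ ξ₀ ξ x g v) :
    Integrable (fun ω => StochSubmod.multilinearExt (StochSubmod.meanFun P fγ) (x T ω)) μ ∧
    ∀ y ∈ StochSubmod.feasiblePolytope ℐ,
      Real.exp (-1) * StochSubmod.multilinearExt (StochSubmod.meanFun P fγ) y
          - 2.5 * √((StochSubmod.rank ℐ : ℝ) ^ 3 * (Fintype.card N : ℝ))
            * StochSubmod.marginalBound P fγ / (T : ℝ)
        ≤ ∫ ω, StochSubmod.multilinearExt (StochSubmod.meanFun P fγ) (x T ω) ∂μ := by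
  have hF := hrun.integrable_multilinearExt hT (StochSubmod.meanFun P fγ) le_rfl
  refine ⟨hF, fun y hy => ?_⟩
  have hTpos : (0 : ℝ) < T := by exact_mod_cast hT
  obtain ⟨hy0, hy1⟩ := StochSubmod.feasiblePolytope_subset_Icc hy
  -- At rank `0` the condition on `M₀` reads `0 ≤ M₀` (division by zero), so the initial batch may
  -- be empty. The polytope is then `{0}`, and the run never leaves the origin.
  rcases Nat.eq_zero_or_pos (StochSubmod.rank ℐ) with hr | hr
  · have hzero : ∀ z ∈ StochSubmod.feasiblePolytope ℐ, z = 0 := fun z hz => by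
      have hz0 := (StochSubmod.feasiblePolytope_subset_Icc hz).1
      have hs := StochSubmod.sum_le_rank hz
      rw [hr, Nat.cast_zero] at hs
      have h := (Finset.sum_eq_zero_iff_of_nonneg fun i _ => hz0 i).1
        (le_antisymm hs (Finset.sum_nonneg fun i _ => hz0 i))
      exact funext fun i => h i (Finset.mem_univ i)
    have hx : ∀ t ≤ T, ∀ ω, x t ω = 0 := by
      intro t
      induction t with
      | zero => exact fun _ => hrun.x_zero
      | succ t ih =>
        intro ht ω
        rw [hrun.x_succ t ht, ih (by omega), hzero _ (hrun.v_mem t ht ω).1, smul_zero, add_zero]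
    have hpos := StochSubmod.multilinearExt_nonneg hnonneg (le_refl (0 : N → ℝ)) zero_le_one
    have hexp : Real.exp (-1) ≤ 1 := Real.exp_le_one_iff.2 (by norm_num)
    simp only [hx T le_rfl, hzero y hy, hr, integral_const, probReal_univ, one_smul]
    simpa using mul_le_of_le_one_left hpos hexp
  · set C := 2.5 * √((StochSubmod.rank ℐ : ℝ) ^ 3 * (Fintype.card N : ℝ)) with hC
    have hC0 : 0 ≤ C := by positivity
    refine le_of_forall_pos_le_add fun δ hδ => ?_
    -- The excess of `D'` over `D_f` is chosen so that it costs at most `δ`; the `+ 1` avoids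
    -- dividing by a vanishing `C`.
    have hε : 0 < δ * T / (C + 1) := by positivity
    have h := StochSubmod.le_integral_of_rank_pos hrun hmeas hint hnonneg hsub hmarg hdown hT hM
      hM₀ hr hy (lt_add_of_pos_right (StochSubmod.marginalBound P fγ) hε)
    rw [← hC] at h
    have e : C * (StochSubmod.marginalBound P fγ + δ * T / (C + 1)) / T =
        C * StochSubmod.marginalBound P fγ / T + δ * (C / (C + 1)) := by
      field_simp
    have hle : δ * (C / (C + 1)) ≤ δ :=
      mul_le_of_le_one_right hδ.le ((div_le_one (by positivity)).2 (by linarith))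
    linarith
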